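/- Let $k\ge 1$ be an integer, identify $x=(x_1,x_2)\in\mathbb R^2$ with $x_1+ix_2$, and let $\Phi(x;\lambda,\varphi)=\lambda+\psi(x,\varphi)$ with $\psi(x,\varphi)=-\operatorname{Re}\bigl(e^{-i\varphi}(x_1+ix_2)^k\bigr)$, $\lambda\in\mathbb R$, $0\le\varphi<2\pi$. Let $\mathbb Z_k$ act on $\mathbb R^2\setminus\{0\}$ by rotations by multiples of $2\pi/k$, and let $F(\lambda,\varphi)$ be the curve $\{\Phi(\cdot;\lambda,\varphi)=0\}$ in the quotient $(\mathbb R^2\setminus\{0\})/\mathbb Z_k$, each orbit being represented by its unique point $re^{i\theta}$ with $r>0$, $-\pi<k\theta-\varphi\le\pi$. (a) These are the Cormack $\alpha$-curves with $\alpha=k$: for $\lambda\ge 0$, $F(\lambda,\varphi)$ is the curve $\{re^{i\theta}: r>0,\ \lambda=r^k\cos(k(\theta-\varphi')),\ |\theta-\varphi'|\le\pi/(2k)\}$ with $\varphi'=\varphi/k$, and the zero set of $\Phi(\cdot;\lambda,\varphi)$ in $\mathbb R^2\setminus\{0\}$ is the union of the $\alpha$-curves with $\varphi'=(\varphi+2\pi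 j)/k$, $0\le j<k$; the zero set for $(-\lambda,\varphi)$ equals that for $(\lambda,\varphi+\pi)$. (b) Let $f\in L_2(\mathbb R^2)$ be complex-valued and $\mathbb Z_k$-invariant with compact support in $\mathbb R^2\setminus\{0\}$, and put $$Rf(\lambda,\varphi)=\int_{F(\lambda,\varphi)}f\,ds,\qquad Mf(\lambda,\varphi)=\int_{F(\lambda,\varphi)}\frac{f\,ds}{|\nabla_x\Phi|},$$ where $ds$ is Euclidean arc length. For every $\varphi$ the two integrals exist for almost every $\lambda$, the functions $Rf$, $Mf$ are integrable on $\mathbb R\times(0,2\pi]$, and $$f(x)=-\frac{k|x|^{k-1}}{4\pi^2}\,(P)\!\int_0^{2\pi}\!\!\int_{-\infty}^{\infty}\frac{Rf(\lambda,\varphi)\,d\lambda\,d\varphi}{\bigl(\lambda-\operatorname{Re}(e^{-i\varphi}(x_1+ix_2)^k)\bigr)^2} =-\frac{k^2|x|^{2k-2}}{4\pi^2}\,(P)\!\int_0^{2\pi}\!\!\int_{-\infty}^{\infty}\frac{Mf(\lambda,\varphi)\,d\lambda\,d\varphi}{\bigl(\lambda-\operatorname{Re}(e^{-i\varphi}(x_1+ix_2)^k)\bigr)^2}.$$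 Here $(P)\int\!\int g\,\Phi^{-2}$ is the limit, as $\varepsilon\to0$ from either side, of $\int\!\int g\,\operatorname{Re}(\Phi+i\varepsilon)^{-2}\,d\lambda\,d\varphi$. Both formulas hold with the limit in $L_2$ on every compact subset of $\mathbb R^2\setminus\{0\}$, and pointwise at every $x\neq0$ at which $f$ is continuous. -/

import Mathlib

open MeasureTheory Filter Topology
open scoped Real

/-! The Euclidean plane is `ℂ`, a point `x = (x₁, x₂)` being `x₁ + i x₂`; it carries the Euclidean
norm, Lebesgue measure `volume`, and arc length `μH[1]` (one-dimensional Hausdorff measure). -/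

namespace Cormack

noncomputable section

/-- `ψ(x, φ) = - Re (e^{-iφ} (x₁ + i x₂)^k)`. -/
def psi (k : ℕ) (x : ℂ) (φ : ℝ) : ℝ :=
  -(Complex.exp (-(φ : ℂ) * Complex.I) * x ^ k).re

/-- The generating function `Φ(x; t, φ) = t + ψ(x, φ)`. -/
def genFun (k : ℕ) (x : ℂ) (t φ : ℝ) : ℝ := t + psi k x φ

/-- The zero set `Φ(·; t, φ) = 0` in the punctured plane. -/
def zeroSet (k : ℕ) (t φ : ℝ) : Set ℂ := {x | x ≠ 0 ∧ genFun k x t φ = 0}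

/-- The `α`-curve with parameters `t, φ`: the points `x = r e(θ)` with
`t = r^α cos (α (θ - φ))` and `|θ - φ| ≤ π / (2 α)`. -/
def alphaCurve (α t φ : ℝ) : Set ℂ :=
  {x | ∃ r θ : ℝ, 0 < r ∧ |θ - φ| ≤ π / (2 * α) ∧ t = r ^ α * Real.cos (α * (θ - φ)) ∧
    x = (r : ℂ) * Complex.exp ((θ : ℂ) * Complex.I)}

/-- The half-open sector `-π < k θ - φ ≤ π` of the punctured plane, of opening `2π / k`. It contains
exactly one point of each orbit of the group `ℤ_k` of rotations by multiples of `2π / k`. -/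
def sector (k : ℕ) (φ : ℝ) : Set ℂ :=
  {x | ∃ r θ : ℝ, 0 < r ∧ -π < k * θ - φ ∧ k * θ - φ ≤ π ∧
    x = (r : ℂ) * Complex.exp ((θ : ℂ) * Complex.I)}

/-- The curve `F(t, φ) = {Φ = 0}` in the quotient `(ℝ² ∖ {0}) / ℤ_k`, each point of the quotient
being represented by the point of its orbit in the sector. -/
def curve (k : ℕ) (t φ : ℝ) : Set ℂ := zeroSet k t φ ∩ sector k φ

/-- Curve integrals `R f(t, φ) = ∫_{F(t, φ)} f ds`. -/
def curveIntegral (k : ℕ) (f : ℂ → ℂ) (t φ : ℝ) : ℂ :=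
  ∫ x in curve k t φ, f x ∂(μH[1])

/-- The Funk-Radon transform `M f(t, φ) = ∫_{F(t, φ)} f ds / |∇ₓ Φ|`. -/
def funkRadon (k : ℕ) (f : ℂ → ℂ) (t φ : ℝ) : ℂ :=
  curveIntegral k (fun x => ‖gradient (fun y : ℂ => genFun k y t φ) x‖⁻¹ • f x) t φ

/-- `∫₀^{2π} ∫_ℝ g(t, φ) Re (Φ(x; t, φ) + iε)⁻² dt dφ`; the principal value integral of
`g / Φ²` is the limit of this as `ε → 0`. -/
def regIntegral (k : ℕ) (g : ℝ → ℝ → ℂ) (ε : ℝ) (x : ℂ) : ℂ :=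
  ∫ φ in (0 : ℝ)..(2 * π), ∫ t : ℝ,
    (1 / ((genFun k x t φ : ℂ) + (ε : ℂ) * Complex.I) ^ 2).re • g t φ

/-- `u ε → f` in `L²_loc (ℝ² ∖ {0})` as `ε → 0` (from either side). -/
def TendstoL2Loc (u : ℝ → ℂ → ℂ) (f : ℂ → ℂ) : Prop :=
  ∀ K : Set ℂ, IsCompact K → (0 : ℂ) ∉ K →
    Tendsto (fun ε => eLpNorm (fun x => u ε x - f x) 2 (volume.restrict K)) (𝓝[≠] 0) (𝓝 0)

end

end Cormack

namespace Cormack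

open scoped NNReal ENNReal

/-! The map `x ↦ x ^ k` straightens the curves: `Φ(x; t, φ) = 0` says that `z = x ^ k` lies on the
line `Re (e^{-iφ} z) = t`, and on one sector the map is a bijection onto that line (without the
origin). Arc length on the curve becomes `|z|^{1/k - 1} / k` times length on the line. For invariant
`f`, the value of `f` depends on `z` alone, so `R f(t, φ)` is the classical Radon transform of the
single planar function `h(z) = (|z|^{1/k - 1} / k) f(z^{1/k})`, called `lineDensity`
(`hausdorffMeasure_image_eq_lintegral`, `curveIntegral_eq`).

Inserting this in the regularized integral and applying Fubini leaves `h` integrated against the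
average over `φ` of `Re (Re (e^{-iφ} (w - z)) + iε)⁻²`. That average is `-2π|ε| (|w - z|² +
ε²)^{-3/2}`, which is `-4π²` times the Poisson kernel of the upper half-space at height `|ε|`
(`intervalIntegral_re_inv_sq_direction`, `integral_lines_eq_poissonConv`). Thus the regularized
integral at `x` is `-4π²` times a Poisson integral of `h` at `x ^ k`. As `ε → 0` the Poisson
integral tends to `h` at points of continuity (`tendsto_poissonConv`) and in `L²`
(`tendsto_lintegral_poissonConv_sub`). Since `k |x|^{k-1} h(x ^ k) = f(x)`, this is the first
formula; the same weight squared is the Jacobian of `x ↦ x ^ k`, which carries `L²` convergence back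
to compact sets avoiding the origin.

The second formula is the first applied to `f / (k |x|^{k-1})`, because `|∇ₓΦ| = k |x|^{k-1}` does
not depend on `t` or `φ` (`norm_gradient_genFun`). -/

/-! ### Arc length as one-dimensional Hausdorff measure. -/

/-- A measure that is locally dominated at the points of `S` is dominated on subsets of `S`. -/
theorem measure_le_of_locally_le {X : Type*} [TopologicalSpace X] [SecondCountableTopology X]
    [MeasurableSpace X] [OpensMeasurableSpace X] {μ ν : Measure X} {S : Set X}
    (h : ∀ x ∈ S, ∃ V ∈ 𝓝 x, ∀ A ⊆ V, MeasurableSet A → μ A ≤ ν A)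
    {A : Set X} (hA : MeasurableSet A) (hAS : A ⊆ S) : μ A ≤ ν A := by
  have h' : ∀ x : X, ∃ V : Set X, IsOpen V ∧
      (x ∈ S → x ∈ V ∧ ∀ A ⊆ V, MeasurableSet A → μ A ≤ ν A) := by
    intro x
    by_cases hx : x ∈ S
    · obtain ⟨V, hV, hle⟩ := h x hx
      obtain ⟨W, hWV, hW, hxW⟩ := mem_nhds_iff.1 hV
      exact ⟨W, hW, fun _ => ⟨hxW, fun A hA => hle A (hA.trans hWV)⟩⟩
    · exact ⟨∅, isOpen_empty, fun h => absurd h hx⟩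
  choose V hVo hV using h'
  -- Countably many of the neighbourhoods cover `S`; made disjoint, they cut `A` into pieces on
  -- which the local inequality sums.
  obtain ⟨t, htS, htc, hcov⟩ := TopologicalSpace.countable_cover_nhdsWithin (s := S) (f := V)
    (fun x hx => mem_nhdsWithin_of_mem_nhds ((hVo x).mem_nhds (hV x hx).1))
  rcases t.eq_empty_or_nonempty with rfl | hne
  · have : A = ∅ := by
      apply Set.eq_empty_of_subset_empty
      exact (hAS.trans hcov).trans (by simp)
    simp [this]
  obtain ⟨u, rfl⟩ := htc.exists_eq_range hne
  have hcov' : A ⊆ ⋃ n, disjointed (fun n => V (u n)) n := by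
    rw [iUnion_disjointed]
    refine (hAS.trans hcov).trans ?_
    simp
  have hm : ∀ n, MeasurableSet (disjointed (fun n => V (u n)) n) :=
    fun n => MeasurableSet.disjointed (fun n => (hVo _).measurableSet) n
  have hd : Pairwise (Function.onFun Disjoint
      fun n => A ∩ disjointed (fun n => V (u n)) n) := fun i j hij =>
    ((disjoint_disjointed (fun n => V (u n))) hij).mono Set.inter_subset_right
      Set.inter_subset_right
  have hAeq : A = ⋃ n, A ∩ disjointed (fun n => V (u n)) n := by
    rw [← Set.inter_iUnion, Set.inter_eq_left.2 hcov']
  rw [hAeq, measure_iUnion hd fun n => hA.inter (hm n), measure_iUnion hd fun n => hA.inter (hm n)]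
  refine ENNReal.tsum_le_tsum fun n => ?_
  exact (hV (u n) (htS (Set.mem_range_self n))).2 _
    (Set.inter_subset_right.trans (disjointed_subset _ n)) (hA.inter (hm n))

/-- Near a point where the derivative does not vanish, a curve changes lengths by nearly
the norm of its derivative. -/
theorem exists_nhds_hausdorffMeasure_image_le {E : Type*} [NormedAddCommGroup E] [NormedSpace ℝ E]
    [MeasurableSpace E] [BorelSpace E] {γ : ℝ → E} {γ' : E} {s : ℝ}
    (h : HasStrictDerivAt γ γ' s) (h0 : γ' ≠ 0) {K : ℝ≥0} (hK : 1 < K) :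
    ∃ V ∈ 𝓝 s, ∀ A ⊆ V, μH[1] (γ '' A) ≤ (K * ‖γ'‖₊ : ℝ≥0) * volume A ∧
      ‖γ'‖₊ * volume A ≤ K * μH[1] (γ '' A) := by
  have hm : 0 < ‖γ'‖ := norm_pos_iff.2 h0
  have hK' : (1 : ℝ) < K := by exact_mod_cast hK
  have hK0 : (0 : ℝ) < K := by linarith
  -- With this error the difference quotients have norm between `‖γ'‖ / K` and `(2 - 1/K) ‖γ'‖`, and
  -- `2 - 1/K ≤ K`.
  set c : ℝ := (1 - (K : ℝ)⁻¹) * ‖γ'‖ with hc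
  have hinv : (K : ℝ)⁻¹ < 1 := inv_lt_one_of_one_lt₀ hK'
  have hc0 : 0 < c := mul_pos (by linarith) hm
  have hev := (hasStrictFDerivAt_iff_isLittleO.1 h.hasStrictFDerivAt).def hc0
  rw [nhds_prod_eq] at hev
  obtain ⟨V, hV, hVle⟩ := eventually_prod_self_iff (r := fun a b =>
    ‖γ a - γ b - ContinuousLinearMap.toSpanSingleton ℝ γ' (a - b)‖ ≤ c * ‖a - b‖).1 hev
  have key : ∀ a ∈ V, ∀ b ∈ V, ‖γ a - γ b‖ ≤ K * ‖γ'‖ * |a - b| ∧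
      ‖γ'‖ * |a - b| ≤ K * ‖γ a - γ b‖ := by
    intro a ha b hb
    have h1 := hVle a ha b hb
    simp only [ContinuousLinearMap.toSpanSingleton_apply, Real.norm_eq_abs] at h1
    have h2 : ‖(a - b) • γ'‖ = |a - b| * ‖γ'‖ := norm_smul _ _
    have h3 : ‖γ a - γ b‖ ≤ ‖γ a - γ b - (a - b) • γ'‖ + ‖(a - b) • γ'‖ := by
      simpa using norm_add_le (γ a - γ b - (a - b) • γ') ((a - b) • γ')
    have h4 : ‖(a - b) • γ'‖ ≤ ‖γ a - γ b‖ + ‖γ a - γ b - (a - b) • γ'‖ := by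
      have := norm_sub_le (γ a - γ b) (γ a - γ b - (a - b) • γ')
      simpa using this
    have hab := abs_nonneg (a - b)
    have h5 : (K : ℝ) * (K : ℝ)⁻¹ = 1 := mul_inv_cancel₀ hK0.ne'
    constructor
    · have h6 : 1 + (1 - (K : ℝ)⁻¹) ≤ K := by
        have : (K - 1) * (1 - (K : ℝ)⁻¹) ≥ 0 := mul_nonneg (by linarith) (by linarith)
        nlinarith
      have h7 := mul_le_mul_of_nonneg_right h6 (mul_nonneg hm.le hab)
      rw [hc] at h1
      nlinarith
    · have h8 : (K : ℝ)⁻¹ * (‖γ'‖ * |a - b|) ≤ ‖γ a - γ b‖ := by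
        rw [hc] at h1
        nlinarith
      calc ‖γ'‖ * |a - b| = K * ((K : ℝ)⁻¹ * (‖γ'‖ * |a - b|)) := by
            rw [← mul_assoc, h5, one_mul]
        _ ≤ _ := by gcongr
  refine ⟨V, hV, fun A hA => ⟨?_, ?_⟩⟩
  · have hL : LipschitzOnWith (K * ‖γ'‖₊) γ A := by
      refine LipschitzOnWith.of_dist_le_mul fun a ha b hb => ?_
      rw [dist_eq_norm, Real.dist_eq]
      exact (key a (hA ha) b (hA hb)).1
    have := hL.hausdorffMeasure_image_le (d := 1) zero_le_one
    rwa [ENNReal.rpow_one, hausdorffMeasure_real] at this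
  · have hinj : Set.InjOn γ A := by
      intro a ha b hb hab
      have := (key a (hA ha) b (hA hb)).2
      rw [hab, sub_self, norm_zero, mul_zero] at this
      have h9 : |a - b| ≤ 0 := by
        by_contra hcon
        push Not at hcon
        exact absurd this (not_le.2 (mul_pos hm hcon))
      exact sub_eq_zero.1 (abs_nonpos_iff.1 h9)
    have hL : LipschitzOnWith (K / ‖γ'‖₊) (Function.invFunOn γ A) (γ '' A) := by
      refine LipschitzOnWith.of_dist_le_mul ?_
      rintro _ ⟨a, ha, rfl⟩ _ ⟨b, hb, rfl⟩
      rw [hinj.leftInvOn_invFunOn ha, hinj.leftInvOn_invFunOn hb, Real.dist_eq, dist_eq_norm]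
      have := (key a (hA ha) b (hA hb)).2
      rw [NNReal.coe_div, coe_nnnorm, div_mul_eq_mul_div, le_div_iff₀ hm]
      linarith
    have := hL.hausdorffMeasure_image_le (d := 1) zero_le_one
    rw [ENNReal.rpow_one, hausdorffMeasure_real, hinj.invFunOn_image subset_rfl] at this
    have hm' : ‖γ'‖₊ ≠ 0 := nnnorm_ne_zero_iff.2 h0
    calc (‖γ'‖₊ : ℝ≥0∞) * volume A
        ≤ ‖γ'‖₊ * ((K / ‖γ'‖₊ : ℝ≥0) * μH[1] (γ '' A)) := by gcongr
      _ = K * μH[1] (γ '' A) := by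
        rw [← mul_assoc, ← ENNReal.coe_mul, mul_div_cancel₀ _ hm']

/-- Lets the distortion in the local length estimates tend to `1`. -/
theorem ennreal_le_of_forall_one_lt_sq_mul {a b : ℝ≥0∞} (h : ∀ K : ℝ≥0, 1 < K → a ≤ K ^ 2 * b) :
    a ≤ b := by
  rcases eq_or_ne b ∞ with rfl | hb
  · exact le_top
  have ht : Tendsto (fun K : ℝ≥0 => (K : ℝ≥0∞) ^ 2 * b) (𝓝[>] 1) (𝓝 ((1 : ℝ≥0) ^ 2 * b)) := by
    refine Tendsto.mono_left ?_ nhdsWithin_le_nhds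
    refine ENNReal.Tendsto.mul_const ?_ (Or.inr hb)
    exact ((ENNReal.continuous_pow 2).comp ENNReal.continuous_coe).tendsto 1
  have := ge_of_tendsto ht (eventually_mem_nhdsWithin.mono fun K hK => h K hK)
  simpa using this

/-- Arc length formula: the length of the image of a set under an injective regular `C¹` curve is
the integral of the speed. -/
theorem hausdorffMeasure_image_eq_lintegral {E : Type*} [NormedAddCommGroup E] [NormedSpace ℝ E]
    [MeasurableSpace E] [BorelSpace E] {γ γ' : ℝ → E} (hγ : MeasurableEmbedding γ)
    {S : Set ℝ} (h : ∀ s ∈ S, HasStrictDerivAt γ (γ' s) s) (h0 : ∀ s ∈ S, γ' s ≠ 0)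
    (hc : ∀ s ∈ S, ContinuousAt γ' s)
    {A : Set ℝ} (hA : MeasurableSet A) (hAS : A ⊆ S) :
    μH[1] (γ '' A) = ∫⁻ s in A, ‖γ' s‖₊ := by
  have hloc : ∀ K : ℝ≥0, 1 < K → ∀ s ∈ S, ∃ V ∈ 𝓝 s, ∀ A ⊆ V, MeasurableSet A →
      μH[1] (γ '' A) ≤ (K : ℝ≥0∞) ^ 2 * ∫⁻ s in A, ‖γ' s‖₊ ∧
        ∫⁻ s in A, ‖γ' s‖₊ ≤ (K : ℝ≥0∞) ^ 2 * μH[1] (γ '' A) := by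
    intro K hK s hs
    obtain ⟨V, hV, hle⟩ := exists_nhds_hausdorffMeasure_image_le (h s hs) (h0 s hs) hK
    have hm : 0 < ‖γ' s‖₊ := nnnorm_pos.2 (h0 s hs)
    have hn : ContinuousAt (fun u => ‖γ' u‖₊) s := (hc s hs).nnnorm
    -- One factor `K` is the distortion of the curve near `s`, the other the oscillation of the
    -- speed; hence `K ^ 2`.
    have h1 : ∀ᶠ u in 𝓝 s, ‖γ' u‖₊ < K * ‖γ' s‖₊ :=
      hn.eventually_lt_const (by simpa using mul_lt_mul_of_pos_right hK hm)
    have h2 : ∀ᶠ u in 𝓝 s, ‖γ' s‖₊ < K * ‖γ' u‖₊ :=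
      (continuousAt_const.mul hn).eventually_const_lt
        (by simpa using mul_lt_mul_of_pos_right hK hm)
    refine ⟨V ∩ {u | ‖γ' u‖₊ < K * ‖γ' s‖₊ ∧ ‖γ' s‖₊ < K * ‖γ' u‖₊},
      inter_mem hV (h1.and h2), fun A hAV hA => ?_⟩
    obtain ⟨hle1, hle2⟩ := hle A (hAV.trans Set.inter_subset_left)
    constructor
    · calc μH[1] (γ '' A) ≤ (K * ‖γ' s‖₊ : ℝ≥0) * volume A := hle1
        _ = K * ∫⁻ _ in A, ‖γ' s‖₊ := by
          rw [setLIntegral_const, ENNReal.coe_mul, mul_assoc]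
        _ ≤ K * ∫⁻ u in A, K * ‖γ' u‖₊ := by
          gcongr 1
          refine setLIntegral_mono' hA fun u hu => ?_
          exact_mod_cast (hAV hu).2.2.le
        _ = _ := by
          rw [lintegral_const_mul' _ _ ENNReal.coe_ne_top, ← mul_assoc, sq]
    · calc ∫⁻ u in A, (‖γ' u‖₊ : ℝ≥0∞) ≤ ∫⁻ _ in A, K * ‖γ' s‖₊ := by
            refine setLIntegral_mono' hA fun u hu => ?_
            exact_mod_cast (hAV hu).2.1.le
        _ = K * (‖γ' s‖₊ * volume A) := by rw [setLIntegral_const, mul_assoc]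
        _ ≤ K * (K * μH[1] (γ '' A)) := by gcongr
        _ = _ := by rw [← mul_assoc, sq]
  have e1 : ∀ B, (μH[1] : Measure E).comap γ B = μH[1] (γ '' B) := fun B => hγ.comap_apply _ _
  have e2 : ∀ B, MeasurableSet B → volume.withDensity (fun s => (‖γ' s‖₊ : ℝ≥0∞)) B =
      ∫⁻ s in B, ‖γ' s‖₊ := fun B hB => withDensity_apply _ hB
  rw [← e1, ← e2 A hA]
  refine le_antisymm ?_ ?_
  · refine ennreal_le_of_forall_one_lt_sq_mul fun K hK => ?_
    have := measure_le_of_locally_le (μ := (μH[1] : Measure E).comap γ)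
      (ν := (K : ℝ≥0∞) ^ 2 • volume.withDensity (fun s => (‖γ' s‖₊ : ℝ≥0∞))) (S := S) ?_ hA hAS
    · simpa using this
    · intro s hs
      obtain ⟨V, hV, hle⟩ := hloc K hK s hs
      refine ⟨V, hV, fun B hB hBm => ?_⟩
      rw [Measure.smul_apply, e1, e2 B hBm]
      exact (hle B hB hBm).1
  · refine ennreal_le_of_forall_one_lt_sq_mul fun K hK => ?_
    have := measure_le_of_locally_le (ν := (K : ℝ≥0∞) ^ 2 • (μH[1] : Measure E).comap γ)
      (μ := volume.withDensity (fun s => (‖γ' s‖₊ : ℝ≥0∞))) (S := S) ?_ hA hAS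
    · simpa using this
    · intro s hs
      obtain ⟨V, hV, hle⟩ := hloc K hK s hs
      refine ⟨V, hV, fun B hB hBm => ?_⟩
      rw [Measure.smul_apply, e1, e2 B hBm]
      exact (hle B hB hBm).2

/-! ### The `k`-th root and the curves as images of lines. -/

/-- The principal `k`-th root. -/
noncomputable def root (k : ℕ) (z : ℂ) : ℂ := z ^ ((k : ℂ)⁻¹)

theorem root_pow {k : ℕ} (hk : k ≠ 0) (z : ℂ) : root k z ^ k = z := Complex.cpow_nat_inv_pow z hk

theorem measurable_root (k : ℕ) : Measurable (root k) := by
  unfold root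
  fun_prop

theorem root_exp (k : ℕ) {w : ℂ} (h1 : -π < w.im) (h2 : w.im ≤ π) :
    root k (Complex.exp w) = Complex.exp (w / k) := by
  rw [root, Complex.cpow_def_of_ne_zero (Complex.exp_ne_zero _), Complex.log_exp h1 h2,
    div_eq_mul_inv]

theorem hasStrictDerivAt_root (k : ℕ) {z : ℂ} (hz : z ∈ Complex.slitPlane) :
    HasStrictDerivAt (root k) ((k : ℂ)⁻¹ * z ^ ((k : ℂ)⁻¹ - 1)) z :=
  Complex.hasStrictDerivAt_cpow_const hz

theorem norm_deriv_root (k : ℕ) (z : ℂ) :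
    ‖(k : ℂ)⁻¹ * z ^ ((k : ℂ)⁻¹ - 1)‖ = (k : ℝ)⁻¹ * ‖z‖ ^ ((k : ℝ)⁻¹ - 1) := by
  rw [norm_mul, ← Complex.norm_cpow_real]
  push_cast
  simp

/-- The point with signed distance `t` from the origin and parameter `s` on the line
`Re (e^{-iφ} z) = t`. -/
noncomputable def linePoint (t φ s : ℝ) : ℂ :=
  Complex.exp ((φ : ℂ) * Complex.I) * ((t : ℂ) + (s : ℂ) * Complex.I)

/-- The parametrization of the curve with parameters `t, φ` by the line that is its image under
`x ↦ x ^ k`. -/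
noncomputable def branch (k : ℕ) (t φ s : ℝ) : ℂ :=
  Complex.exp (((φ / k : ℝ) : ℂ) * Complex.I) * root k ((t : ℂ) + (s : ℂ) * Complex.I)

theorem norm_linePoint (t φ s : ℝ) :
    ‖linePoint t φ s‖ = ‖(t : ℂ) + (s : ℂ) * Complex.I‖ := by
  rw [linePoint, norm_mul, Complex.norm_exp_ofReal_mul_I, one_mul]

theorem branch_pow {k : ℕ} (hk : k ≠ 0) (t φ s : ℝ) : branch k t φ s ^ k = linePoint t φ s := by
  have hk' : (k : ℂ) ≠ 0 := Nat.cast_ne_zero.2 hk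
  rw [branch, linePoint, mul_pow, root_pow hk, ← Complex.exp_nat_mul]
  congr 2
  push_cast
  field_simp

theorem linePoint_injective (t φ : ℝ) : Function.Injective (linePoint t φ) := by
  intro a b hab
  have := mul_left_cancel₀ (Complex.exp_ne_zero _) hab
  simpa using congrArg Complex.im this

/-- Injective because its `k`-th power is. Measurability suffices between standard Borel spaces, so
the jump of the root at its cut is harmless. -/
theorem measurableEmbedding_branch {k : ℕ} (hk : k ≠ 0) (t φ : ℝ) :
    MeasurableEmbedding (branch k t φ) := by
  refine Measurable.measurableEmbedding ?_ ?_
  · exact ((measurable_root k).comp (by fun_prop)).const_mul _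
  · intro a b hab
    apply linePoint_injective t φ
    rw [← branch_pow hk, ← branch_pow hk, hab]

theorem genFun_eq (k : ℕ) (x : ℂ) (t φ : ℝ) :
    genFun k x t φ = t - (Complex.exp (-(φ : ℂ) * Complex.I) * x ^ k).re := by
  rw [genFun, psi, sub_eq_add_neg]

theorem genFun_polar (k : ℕ) (r θ t φ : ℝ) :
    genFun k ((r : ℂ) * Complex.exp ((θ : ℂ) * Complex.I)) t φ =
      t - r ^ k * Real.cos (k * θ - φ) := by
  rw [genFun_eq, mul_pow, ← Complex.exp_nat_mul, mul_left_comm, ← Complex.exp_add,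
    show -(φ : ℂ) * Complex.I + (k : ℂ) * ((θ : ℂ) * Complex.I) =
      ((k * θ - φ : ℝ) : ℂ) * Complex.I by push_cast; ring, ← Complex.ofReal_pow,
    Complex.re_ofReal_mul, Complex.exp_ofReal_mul_I_re]

theorem genFun_eq_zero_iff {k : ℕ} {x : ℂ} {t φ : ℝ} :
    genFun k x t φ = 0 ↔ ∃ s : ℝ, x ^ k = linePoint t φ s := by
  have h : Complex.exp ((φ : ℂ) * Complex.I) * Complex.exp (-(φ : ℂ) * Complex.I) = 1 := by
    rw [← Complex.exp_add, neg_mul, add_neg_cancel, Complex.exp_zero]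
  rw [genFun_eq, sub_eq_zero]
  constructor
  · intro ht
    refine ⟨(Complex.exp (-(φ : ℂ) * Complex.I) * x ^ k).im, ?_⟩
    rw [linePoint, ht, Complex.re_add_im, ← mul_assoc, h, one_mul]
  · rintro ⟨s, hs⟩
    rw [hs, linePoint, ← mul_assoc, mul_comm (Complex.exp _), h, one_mul]
    simp

/-- The half-open range `(-π, π]` of the principal argument is exactly the sector condition. -/
theorem branch_mem_sector {k : ℕ} (hk : k ≠ 0) {t φ s : ℝ}
    (h : (t : ℂ) + (s : ℂ) * Complex.I ≠ 0) : branch k t φ s ∈ sector k φ := by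
  set w := (t : ℂ) + (s : ℂ) * Complex.I
  have hk' : (k : ℂ) ≠ 0 := Nat.cast_ne_zero.2 hk
  have hkr : (k : ℝ) ≠ 0 := Nat.cast_ne_zero.2 hk
  refine ⟨Real.exp ((Complex.log w).re / k), φ / k + w.arg / k, Real.exp_pos _, ?_, ?_, ?_⟩
  · have := Complex.neg_pi_lt_arg w
    field_simp; linarith
  · have := Complex.arg_le_pi w
    field_simp; linarith
  · have e : root k w = Complex.exp (Complex.log w / k) := by
      rw [← root_exp k (Complex.neg_pi_lt_log_im w) (Complex.log_im_le_pi w), Complex.exp_log h]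
    rw [branch, e, Complex.ofReal_exp, ← Complex.exp_add, ← Complex.exp_add]
    congr 1
    conv_lhs => rw [← Complex.re_add_im (Complex.log w), Complex.log_im]
    push_cast
    ring

theorem branch_eq_of_mem_sector {k : ℕ} (hk : k ≠ 0) {t φ s : ℝ} {x : ℂ} (hx : x ∈ sector k φ)
    (h : x ^ k = linePoint t φ s) : branch k t φ s = x := by
  obtain ⟨r, θ, hr, h1, h2, rfl⟩ := hx
  have hk' : (k : ℂ) ≠ 0 := Nat.cast_ne_zero.2 hk
  have hr' : (r : ℂ) = Complex.exp (Real.log r : ℝ) := by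
    rw [← Complex.ofReal_exp, Real.exp_log hr]
  have e : (t : ℂ) + (s : ℂ) * Complex.I =
      Complex.exp (k * Real.log r + ((k * θ - φ : ℝ) : ℂ) * Complex.I) := by
    apply mul_left_cancel₀ (Complex.exp_ne_zero ((φ : ℂ) * Complex.I))
    rw [← linePoint, ← h, hr', mul_pow, ← Complex.exp_nat_mul, ← Complex.exp_nat_mul,
      ← Complex.exp_add, ← Complex.exp_add]
    congr 1
    push_cast
    ring
  rw [branch, e, root_exp, hr', ← Complex.exp_add, ← Complex.exp_add]
  · congr 1
    push_cast
    field_simp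
    ring
  · simpa using h1
  · simpa using h2

/-- The origin is on the parametrized line only for `t = 0`; being a single point, it does not
affect arc length. -/
theorem curve_eq_range_sdiff {k : ℕ} (hk : k ≠ 0) (t φ : ℝ) :
    curve k t φ = Set.range (branch k t φ) \ {0} := by
  ext x
  constructor
  · rintro ⟨⟨hx0, hx⟩, hs⟩
    obtain ⟨s, hs'⟩ := genFun_eq_zero_iff.1 hx
    exact ⟨⟨s, branch_eq_of_mem_sector hk hs hs'⟩, hx0⟩
  · rintro ⟨⟨s, rfl⟩, hx0⟩
    refine ⟨⟨hx0, genFun_eq_zero_iff.2 ⟨s, branch_pow hk t φ s⟩⟩, branch_mem_sector hk ?_⟩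
    intro h0
    apply hx0
    have := branch_pow hk t φ s
    rw [linePoint, h0, mul_zero] at this
    exact pow_eq_zero_iff hk |>.1 this

/-! ### The curves as `α`-curves -/

theorem zeroSet_neg (k : ℕ) (t φ : ℝ) : zeroSet k (-t) φ = zeroSet k t (φ + π) := by
  ext x
  have : Complex.exp (-((φ + π : ℝ) : ℂ) * Complex.I) = -Complex.exp (-(φ : ℂ) * Complex.I) := by
    push_cast
    rw [neg_add, add_mul, Complex.exp_add, neg_mul (π : ℂ), Complex.exp_neg_pi_mul_I]
    ring
  simp only [zeroSet, Set.mem_ofPred_eq, genFun_eq, this]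
  rw [neg_mul (Complex.exp _), Complex.neg_re]
  refine and_congr_right fun _ => ?_
  constructor <;> intro h <;> linarith

theorem mul_sub_div_natCast {k : ℕ} (hk : k ≠ 0) (θ φ : ℝ) : k * (θ - φ / k) = k * θ - φ := by
  have hkr : (k : ℝ) ≠ 0 := Nat.cast_ne_zero.2 hk
  field_simp

theorem abs_sub_div_le_iff {k : ℕ} (hk : k ≠ 0) (θ φ : ℝ) :
    |θ - φ / k| ≤ π / (2 * k) ↔ |k * θ - φ| ≤ π / 2 := by
  have hkr : (0 : ℝ) < k := Nat.cast_pos.2 (Nat.pos_of_ne_zero hk)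
  rw [← mul_sub_div_natCast hk, abs_mul, abs_of_pos hkr, ← div_div, le_div_iff₀' hkr]

theorem curve_eq_alphaCurve {k : ℕ} (hk : k ≠ 0) {t : ℝ} (ht : 0 ≤ t) (φ : ℝ) :
    curve k t φ = alphaCurve k t (φ / k) := by
  ext x
  constructor
  · rintro ⟨⟨-, hx⟩, r, θ, hr, h1, h2, rfl⟩
    rw [genFun_polar, sub_eq_zero] at hx
    refine ⟨r, θ, hr, ?_, ?_, rfl⟩
    · rw [abs_sub_div_le_iff hk]
      by_contra hcon
      push Not at hcon
      -- For `t ≥ 0` the cosine cannot be negative, which halves the admissible range of angles from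
      -- `π` to `π / 2`.
      have hneg : Real.cos |k * θ - φ| < 0 :=
        Real.cos_neg_of_pi_div_two_lt_of_lt hcon
          (by have := abs_le.2 ⟨h1.le, h2⟩; linarith [Real.pi_pos])
      rw [Real.cos_abs] at hneg
      have : r ^ k * Real.cos (k * θ - φ) < 0 := mul_neg_of_pos_of_neg (pow_pos hr k) hneg
      linarith
    · rw [mul_sub_div_natCast hk, Real.rpow_natCast, hx]
  · rintro ⟨r, θ, hr, h1, h2, rfl⟩
    rw [abs_sub_div_le_iff hk, abs_le] at h1
    rw [mul_sub_div_natCast hk, Real.rpow_natCast] at h2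
    refine ⟨⟨?_, ?_⟩, r, θ, hr, ?_, ?_, rfl⟩
    · exact mul_ne_zero (by exact_mod_cast hr.ne') (Complex.exp_ne_zero _)
    · rw [genFun_polar, h2, sub_self]
    · linarith [Real.pi_pos]
    · linarith [Real.pi_pos]

theorem zeroSet_add_two_pi_mul (k : ℕ) (t φ : ℝ) (j : ℕ) :
    zeroSet k t (φ + 2 * π * j) = zeroSet k t φ := by
  have : Complex.exp (-((φ + 2 * π * j : ℝ) : ℂ) * Complex.I) =
      Complex.exp (-(φ : ℂ) * Complex.I) := by
    rw [Complex.exp_eq_exp_iff_exists_int]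
    exact ⟨-j, by push_cast; ring⟩
  ext x
  simp only [zeroSet, Set.mem_ofPred_eq, genFun_eq, this]

theorem exists_mem_sector {k : ℕ} (hk : k ≠ 0) (φ : ℝ) {x : ℂ} (hx : x ≠ 0) :
    ∃ j : Fin k, x ∈ sector k (φ + 2 * π * (j : ℕ)) := by
  have hkr : (k : ℝ) ≠ 0 := Nat.cast_ne_zero.2 hk
  obtain ⟨m, ⟨hm1, hm2⟩, -⟩ := existsUnique_add_zsmul_mem_Ioc Real.two_pi_pos
    (k * x.arg - φ) (-π)
  have hkz : (0 : ℤ) < k := by exact_mod_cast Nat.pos_of_ne_zero hk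
  -- Write `-m = k l + j` with `0 ≤ j < k`: the remainder `j` selects the sector, and `l` is
  -- absorbed into `θ` by full turns.
  set j : ℤ := (-m) % k with hj
  have hj0 : 0 ≤ j := Int.emod_nonneg _ hkz.ne'
  have hjk : j < k := Int.emod_lt_of_pos _ hkz
  set l : ℤ := (-m) / k with hl
  have hml : (k : ℤ) * l + j = -m := Int.mul_ediv_add_emod _ _
  have hml' : (k : ℝ) * l + j = -m := by exact_mod_cast hml
  have hjc : ((j.toNat : ℕ) : ℝ) = (j : ℝ) := by
    exact_mod_cast Int.toNat_of_nonneg hj0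
  refine ⟨⟨j.toNat, by omega⟩, ‖x‖, x.arg - 2 * π * l, norm_pos_iff.2 hx, ?_, ?_, ?_⟩
  · simp only [hjc]
    rw [zsmul_eq_mul] at hm1
    linear_combination hm1 + (2 * π) * hml'
  · simp only [hjc]
    rw [zsmul_eq_mul] at hm2
    linear_combination hm2 - (2 * π) * hml'
  · have : Complex.exp (((x.arg - 2 * π * l : ℝ) : ℂ) * Complex.I) =
        Complex.exp ((x.arg : ℂ) * Complex.I) := by
      rw [Complex.exp_eq_exp_iff_exists_int]
      exact ⟨-l, by push_cast; ring⟩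
    rw [this, Complex.norm_mul_exp_arg_mul_I]

/-- Replacing `φ` by `φ + 2πj` keeps the zero set but moves the sector; the `k` sectors together
cover the punctured plane. -/
theorem zeroSet_eq_iUnion_alphaCurve {k : ℕ} (hk : k ≠ 0) {t : ℝ} (ht : 0 ≤ t) (φ : ℝ) :
    zeroSet k t φ = ⋃ j : Fin k, alphaCurve k t ((φ + 2 * π * (j : ℕ)) / k) := by
  simp only [← curve_eq_alphaCurve hk ht, curve, zeroSet_add_two_pi_mul, ← Set.inter_iUnion]
  refine (Set.inter_eq_left.2 fun x hx => ?_).symm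
  exact Set.mem_iUnion.2 (exists_mem_sector hk φ hx.1)

/-! ### Arc length on the curves -/

/-- The density that turns integrals of `f` along the curves into integrals along lines. -/
noncomputable def lineDensity (k : ℕ) (f : ℂ → ℂ) (z : ℂ) : ℂ :=
  ((k : ℝ)⁻¹ * ‖z‖ ^ ((k : ℝ)⁻¹ - 1)) • f (root k z)

/-- The quotient `x / y` is a `k`-th root of unity, hence a power of the generating rotation. -/
theorem eq_of_pow_eq_pow {k : ℕ} (hk : k ≠ 0) {f : ℂ → ℂ}
    (hf : ∀ x : ℂ, f (Complex.exp (2 * π * Complex.I / k) * x) = f x) {x y : ℂ}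
    (h : x ^ k = y ^ k) : f x = f y := by
  rcases eq_or_ne y 0 with rfl | hy
  · rw [zero_pow hk] at h
    rw [pow_eq_zero_iff hk |>.1 h]
  have : NeZero k := ⟨hk⟩
  have h1 : (x / y) ^ k = 1 := by rw [div_pow, h, div_self (pow_ne_zero k hy)]
  obtain ⟨i, -, hi⟩ := (Complex.isPrimitiveRoot_exp k hk).eq_pow_of_pow_eq_one h1
  have h2 : ∀ n : ℕ, f (Complex.exp (2 * π * Complex.I / k) ^ n * y) = f y := by
    intro n
    induction n with
    | zero => simp
    | succ n ih => rw [pow_succ', mul_assoc, hf, ih]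
  rw [← h2 i, hi, div_mul_cancel₀ _ hy]

theorem comap_branch_hausdorffMeasure {k : ℕ} (hk : k ≠ 0) (t φ : ℝ) :
    (μH[1] : Measure ℂ).comap (branch k t φ) =
      volume.withDensity (fun s : ℝ => ((‖(k : ℂ)⁻¹ *
        ((t : ℂ) + (s : ℂ) * Complex.I) ^ ((k : ℂ)⁻¹ - 1)‖₊ : ℝ≥0) : ℝ≥0∞)) := by
  have hemb := measurableEmbedding_branch hk t φ
  set γ' : ℝ → ℂ := fun s => Complex.exp (((φ / k : ℝ) : ℂ) * Complex.I) *
    (Complex.I * ((k : ℂ)⁻¹ * ((t : ℂ) + (s : ℂ) * Complex.I) ^ ((k : ℂ)⁻¹ - 1))) with hγ'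
  have hnorm : ∀ s, ‖γ' s‖₊ =
      ‖(k : ℂ)⁻¹ * ((t : ℂ) + (s : ℂ) * Complex.I) ^ ((k : ℂ)⁻¹ - 1)‖₊ := by
    intro s
    apply NNReal.eq
    simp only [hγ', coe_nnnorm]
    rw [norm_mul, norm_mul Complex.I, Complex.norm_exp_ofReal_mul_I, Complex.norm_I, one_mul,
      one_mul]
  have hslit : ∀ s ∈ ({0}ᶜ : Set ℝ), (t : ℂ) + (s : ℂ) * Complex.I ∈ Complex.slitPlane := by
    intro s hs
    rw [Complex.mem_slitPlane_iff]
    right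
    simpa using hs
  have hline : ∀ s : ℝ,
      HasStrictDerivAt (fun s : ℝ => (t : ℂ) + (s : ℂ) * Complex.I) Complex.I s := by
    intro s
    have h1 : HasStrictDerivAt (fun s : ℝ => (s : ℂ)) 1 s :=
      Complex.ofRealCLM.hasStrictDerivAt
    simpa using (h1.mul_const Complex.I).const_add (t : ℂ)
  refine Measure.ext fun A hA => ?_
  rw [hemb.comap_apply, withDensity_apply _ hA]
  -- The line can meet the cut of the root only at `s = 0`. That parameter is null for both
  -- measures, and elsewhere the arc length formula applies.
  have hz : (volume : Measure ℝ) {0} = 0 := by simp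
  have hz' : (μH[1] : Measure ℂ) (branch k t φ '' {0}) = 0 := by
    have := Measure.nullSingletonClass_hausdorff ℂ (d := 1) zero_lt_one
    rw [Set.image_singleton]
    exact measure_singleton _
  have h1 : μH[1] (branch k t φ '' A) = μH[1] (branch k t φ '' (A \ {0})) := by
    rw [Set.image_sdiff hemb.injective]
    exact (measure_sdiff_null hz').symm
  rw [h1, ← setLIntegral_congr (sdiff_null_ae_eq_self hz (s := A)),
    hausdorffMeasure_image_eq_lintegral (γ' := γ') hemb (S := {0}ᶜ) ?_ ?_ ?_
      (hA.diff (measurableSet_singleton 0)) (fun x hx => hx.2)]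
  · simp only [hnorm]
  · intro s hs
    exact ((hasStrictDerivAt_root k (hslit s hs)).scomp s (hline s)).const_mul _
  · intro s hs
    have := Complex.slitPlane_ne_zero (hslit s hs)
    refine mul_ne_zero (Complex.exp_ne_zero _) (mul_ne_zero Complex.I_ne_zero
      (mul_ne_zero (inv_ne_zero (Nat.cast_ne_zero.2 hk)) ?_))
    rw [Complex.cpow_def_of_ne_zero this]
    exact Complex.exp_ne_zero _
  · intro s hs
    have : ContinuousAt (fun s : ℝ => ((t : ℂ) + (s : ℂ) * Complex.I) ^ ((k : ℂ)⁻¹ - 1)) s :=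
      ContinuousAt.comp (f := fun s : ℝ => (t : ℂ) + (s : ℂ) * Complex.I)
        (continuousAt_cpow_const (hslit s hs)) (by fun_prop)
    exact continuousAt_const.mul (continuousAt_const.mul (continuousAt_const.mul this))

theorem restrict_curve_hausdorffMeasure {k : ℕ} (hk : k ≠ 0) (t φ : ℝ) :
    (μH[1] : Measure ℂ).restrict (curve k t φ) =
      (volume.withDensity (fun s : ℝ => ((‖(k : ℂ)⁻¹ *
        ((t : ℂ) + (s : ℂ) * Complex.I) ^ ((k : ℂ)⁻¹ - 1)‖₊ : ℝ≥0) : ℝ≥0∞))).map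
          (branch k t φ) := by
  rw [← comap_branch_hausdorffMeasure hk, (measurableEmbedding_branch hk t φ).map_comap,
    curve_eq_range_sdiff hk]
  have := Measure.nullSingletonClass_hausdorff ℂ (d := 1) zero_lt_one
  exact Measure.restrict_congr_set (sdiff_null_ae_eq_self (measure_singleton _))

/-- Invariance replaces the branch attached to `φ` by the principal root, so the integrand is one
function on the plane, the same for all lines. -/
theorem smul_comp_branch {k : ℕ} (hk : k ≠ 0) {f : ℂ → ℂ}
    (hf : ∀ x : ℂ, f (Complex.exp (2 * π * Complex.I / k) * x) = f x) (t φ s : ℝ) :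
    ‖(k : ℂ)⁻¹ * ((t : ℂ) + (s : ℂ) * Complex.I) ^ ((k : ℂ)⁻¹ - 1)‖₊ • f (branch k t φ s) =
      lineDensity k f (linePoint t φ s) := by
  rw [lineDensity, NNReal.smul_def, coe_nnnorm, norm_deriv_root, norm_linePoint,
    eq_of_pow_eq_pow hk hf (y := root k (linePoint t φ s))]
  rw [root_pow hk, branch_pow hk]

theorem curveIntegral_eq {k : ℕ} (hk : k ≠ 0) {f : ℂ → ℂ}
    (hf : ∀ x : ℂ, f (Complex.exp (2 * π * Complex.I / k) * x) = f x) (t φ : ℝ) :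
    curveIntegral k f t φ = ∫ s, lineDensity k f (linePoint t φ s) := by
  rw [curveIntegral, restrict_curve_hausdorffMeasure hk,
    (measurableEmbedding_branch hk t φ).integral_map, integral_withDensity_eq_integral_smul]
  · simp only [smul_comp_branch hk hf]
  · fun_prop

theorem integrableOn_curve_iff {k : ℕ} (hk : k ≠ 0) {f : ℂ → ℂ}
    (hf : ∀ x : ℂ, f (Complex.exp (2 * π * Complex.I / k) * x) = f x) (t φ : ℝ) :
    IntegrableOn f (curve k t φ) (μH[1]) ↔
      Integrable fun s => lineDensity k f (linePoint t φ s) := by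
  rw [IntegrableOn, restrict_curve_hausdorffMeasure hk,
    (measurableEmbedding_branch hk t φ).integrable_map_iff,
    integrable_withDensity_iff_integrable_smul]
  · simp only [Function.comp_apply, smul_comp_branch hk hf]
  · fun_prop

/-! ### Planar change of variables, and integrability of the line density. -/

theorem hasFDerivAt_real_of_hasDerivAt {g : ℂ → ℂ} {g' z : ℂ} (h : HasDerivAt g g' z) :
    HasFDerivAt g ((ContinuousLinearMap.toSpanSingleton ℂ g').restrictScalars ℝ) z :=
  h.hasFDerivAt.restrictScalars ℝ

/-- The determinant of multiplication by `a` is the field norm of `ℂ` over `ℝ`. -/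
theorem det_restrictScalars_toSpanSingleton (a : ℂ) :
    ((ContinuousLinearMap.toSpanSingleton ℂ a).restrictScalars ℝ).det = ‖a‖ ^ 2 := by
  rw [← Complex.normSq_eq_norm_sq, ← Algebra.norm_complex_apply, Algebra.norm_apply]
  unfold ContinuousLinearMap.det
  congr 1
  ext z
  all_goals simp [mul_comm]

/-- Change of variables for an injective holomorphic map. -/
theorem lintegral_image_eq_lintegral_norm_deriv_sq_mul {g g' : ℂ → ℂ} {S : Set ℂ}
    (hS : MeasurableSet S) (hg : ∀ z ∈ S, HasDerivAt g (g' z) z) (hinj : Set.InjOn g S)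
    (G : ℂ → ℝ≥0∞) :
    ∫⁻ x in g '' S, G x = ∫⁻ z in S, ENNReal.ofReal (‖g' z‖ ^ 2) * G (g z) := by
  rw [lintegral_image_eq_lintegral_abs_det_fderiv_mul volume hS
    (fun z hz => (hasFDerivAt_real_of_hasDerivAt (hg z hz)).hasFDerivWithinAt) hinj]
  simp only [det_restrictScalars_toSpanSingleton, abs_pow, abs_norm]

theorem volume_compl_slitPlane : volume Complex.slitPlaneᶜ = 0 := by
  refine measure_mono_null (t := LinearMap.ker Complex.imLm) ?_ ?_
  · intro z hz
    simp only [Set.mem_compl_iff, Complex.mem_slitPlane_iff, not_or, not_not] at hz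
    simpa using hz.2
  · apply Measure.addHaar_submodule
    intro h
    have : Complex.I ∈ LinearMap.ker Complex.imLm := h ▸ Submodule.mem_top
    simp at this

theorem root_injective {k : ℕ} (hk : k ≠ 0) : Function.Injective (root k) := by
  intro a b hab
  rw [← root_pow hk a, hab, root_pow hk]

theorem lintegral_comp_root_le {k : ℕ} (hk : k ≠ 0) (G : ℂ → ℝ≥0∞) :
    ∫⁻ z, ENNReal.ofReal (((k : ℝ)⁻¹ * ‖z‖ ^ ((k : ℝ)⁻¹ - 1)) ^ 2) * G (root k z) ≤
      ∫⁻ x, G x := by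
  have h := lintegral_image_eq_lintegral_norm_deriv_sq_mul (g := root k)
    Complex.isOpen_slitPlane.measurableSet (fun z hz => (hasStrictDerivAt_root k hz).hasDerivAt)
    (root_injective hk).injOn G
  simp only [norm_deriv_root] at h
  rw [← setLIntegral_univ, ← Set.union_compl_self Complex.slitPlane]
  refine (lintegral_union_le _ _ _).trans ?_
  rw [setLIntegral_measure_zero _ _ volume_compl_slitPlane, add_zero, ← h]
  exact setLIntegral_le_lintegral _ _

/-- Needed because `f` is only almost everywhere equal to a measurable function. The weighted
inequality for the indicator of a null set gives it, the weight being positive off the origin. -/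
theorem quasiMeasurePreserving_root {k : ℕ} (hk : k ≠ 0) :
    Measure.QuasiMeasurePreserving (root k) := by
  refine ⟨measurable_root k, Measure.AbsolutelyContinuous.mk fun N hN hN0 => ?_⟩
  rw [Measure.map_apply (measurable_root k) hN]
  have h := lintegral_comp_root_le hk (N.indicator 1)
  rw [lintegral_indicator_one hN, hN0, nonpos_iff_eq_zero, lintegral_eq_zero_iff] at h
  · have h0 : ∀ᵐ z : ℂ, z ∉ ({0} : Set ℂ) := measure_eq_zero_iff_ae_notMem.1 (measure_singleton 0)
    refine measure_eq_zero_iff_ae_notMem.2 ?_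
    filter_upwards [h, h0] with z hz hz0 hzN
    have : 0 < ‖z‖ := norm_pos_iff.2 hz0
    have hk' : (0 : ℝ) < k := by exact_mod_cast Nat.pos_of_ne_zero hk
    have hpos : 0 < ((k : ℝ)⁻¹ * ‖z‖ ^ ((k : ℝ)⁻¹ - 1)) ^ 2 := by positivity
    rw [Set.indicator_of_mem (show root k z ∈ N from hzN)] at hz
    simp only [Pi.one_apply, mul_one, Pi.zero_apply, ENNReal.ofReal_eq_zero] at hz
    linarith
  · have := (measurable_one.indicator hN (β := ℝ≥0∞)).comp (measurable_root k)
    fun_prop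

theorem aestronglyMeasurable_lineDensity {k : ℕ} (hk : k ≠ 0) {f : ℂ → ℂ}
    (hf : AEStronglyMeasurable f) : AEStronglyMeasurable (lineDensity k f) := by
  have h : Measurable fun z : ℂ => (k : ℝ)⁻¹ * ‖z‖ ^ ((k : ℝ)⁻¹ - 1) := by fun_prop
  exact h.aestronglyMeasurable.smul
    (hf.comp_quasiMeasurePreserving (quasiMeasurePreserving_root hk))

theorem memLp_two_iff_lintegral {g : ℂ → ℂ} (hg : AEStronglyMeasurable g) :
    MemLp g 2 ↔ ∫⁻ z, ‖g z‖ₑ ^ 2 < ∞ := by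
  rw [MemLp, and_iff_right hg, eLpNorm_lt_top_iff_lintegral_rpow_enorm_lt_top two_ne_zero
    ENNReal.ofNat_ne_top]
  simp

/-- The square of the arc length weight is the Jacobian of the root, so the `L²` norm does not
increase. -/
theorem memLp_lineDensity {k : ℕ} (hk : k ≠ 0) {f : ℂ → ℂ} (hf : MemLp f 2) :
    MemLp (lineDensity k f) 2 := by
  rw [memLp_two_iff_lintegral (aestronglyMeasurable_lineDensity hk hf.1)]
  refine lt_of_le_of_lt ?_ ((memLp_two_iff_lintegral hf.1).1 hf)
  refine le_trans (lintegral_mono fun z => ?_) (lintegral_comp_root_le hk _)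
  rw [lineDensity, enorm_smul, mul_pow, Real.enorm_eq_ofReal (by positivity),
    ENNReal.ofReal_pow (by positivity)]

theorem integrable_lineDensity {k : ℕ} (hk : k ≠ 0) {f : ℂ → ℂ} (hf : MemLp f 2)
    (hc : HasCompactSupport f) : Integrable (lineDensity k f) := by
  obtain ⟨R, hR⟩ := hc.isCompact.isBounded.subset_closedBall 0
  have hsupp : Function.support (lineDensity k f) ⊆ Metric.closedBall 0 (R ^ k) := by
    intro z hz
    have h1 : f (root k z) ≠ 0 := by
      intro h; apply hz; simp [lineDensity, h]
    have h2 := hR (subset_tsupport f h1)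
    rw [mem_closedBall_zero_iff] at h2 ⊢
    rw [← root_pow hk z, norm_pow]
    exact pow_le_pow_left₀ (norm_nonneg _) h2 k
  rw [← integrableOn_iff_integrable_of_support_subset hsupp]
  have := (memLp_lineDensity hk hf).restrict (Metric.closedBall 0 (R ^ k))
  have hfin : IsFiniteMeasure (volume.restrict (Metric.closedBall (0 : ℂ) (R ^ k))) :=
    ⟨by rw [Measure.restrict_apply_univ]; exact measure_closedBall_lt_top⟩
  exact this.integrable one_le_two

theorem hasStrictDerivAt_pow_natCast (k : ℕ) (x : ℂ) :
    HasStrictDerivAt (fun x : ℂ => x ^ k) (k * x ^ (k - 1)) x := by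
  simpa using hasStrictDerivAt_pow k x

/-- On compact sets avoiding the origin, the map `x ↦ x ^ k` has finite multiplicity. -/
theorem exists_lintegral_comp_pow_le {k : ℕ} (hk : k ≠ 0) {K : Set ℂ} (hK : IsCompact K)
    (h0 : (0 : ℂ) ∉ K) : ∃ N : ℕ, ∀ G : ℂ → ℝ≥0∞,
      ∫⁻ x in K, ENNReal.ofReal ((k * ‖x‖ ^ (k - 1)) ^ 2) * G (x ^ k) ≤ N * ∫⁻ z, G z := by
  have hmain : ∀ x ∈ K, ∃ V ∈ 𝓝 x, ∀ G : ℂ → ℝ≥0∞,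
      ∫⁻ x in V, ENNReal.ofReal ((k * ‖x‖ ^ (k - 1)) ^ 2) * G (x ^ k) ≤ ∫⁻ z, G z := by
    intro x hx
    have hx0 : x ≠ 0 := fun h => h0 (h ▸ hx)
    have hd := hasStrictDerivAt_pow_natCast k x
    have hne : (k : ℂ) * x ^ (k - 1) ≠ 0 :=
      mul_ne_zero (Nat.cast_ne_zero.2 hk) (pow_ne_zero _ hx0)
    -- By the inverse function theorem the power map is injective near `x ≠ 0`, so the bound holds
    -- there with constant `1`; compactness adds up finitely many.
    have hd' := hd.hasStrictFDerivAt_equiv hne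
    refine ⟨(hd'.toOpenPartialHomeomorph _).source,
      (hd'.toOpenPartialHomeomorph _).open_source.mem_nhds hd'.mem_toOpenPartialHomeomorph_source,
      fun G => ?_⟩
    have hinj := (hd'.toOpenPartialHomeomorph _).injOn
    rw [hd'.toOpenPartialHomeomorph_coe] at hinj
    have h := lintegral_image_eq_lintegral_norm_deriv_sq_mul
      (hd'.toOpenPartialHomeomorph _).open_source.measurableSet
      (fun z _ => (hasStrictDerivAt_pow_natCast k z).hasDerivAt) hinj G
    simp only [norm_mul, norm_pow, Complex.norm_natCast] at h
    rw [← h]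
    exact setLIntegral_le_lintegral _ _
  refine hK.induction_on (p := fun S => ∃ N : ℕ, ∀ G : ℂ → ℝ≥0∞,
      ∫⁻ x in S, ENNReal.ofReal ((k * ‖x‖ ^ (k - 1)) ^ 2) * G (x ^ k) ≤ N * ∫⁻ z, G z) ?_ ?_ ?_ ?_
  · exact ⟨0, by simp⟩
  · rintro S T hST ⟨N, hN⟩
    exact ⟨N, fun G => (lintegral_mono_set hST).trans (hN G)⟩
  · rintro S T ⟨N, hN⟩ ⟨M, hM⟩
    refine ⟨N + M, fun G => (lintegral_union_le _ _ _).trans ?_⟩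
    rw [Nat.cast_add, add_mul]
    exact add_le_add (hN G) (hM G)
  · intro x hx
    obtain ⟨V, hV, h⟩ := hmain x hx
    exact ⟨V, mem_nhdsWithin_of_mem_nhds hV, 1, by simpa using h⟩

/-! ### The average of the kernel over directions. -/

theorem re_one_div_add_mul_I_sq (a ε : ℝ) :
    (1 / ((a : ℂ) + (ε : ℂ) * Complex.I) ^ 2).re = (a ^ 2 - ε ^ 2) / (a ^ 2 + ε ^ 2) ^ 2 := by
  have h1 : ((a : ℂ) + (ε : ℂ) * Complex.I) ^ 2 = ⟨a ^ 2 - ε ^ 2, 2 * a * ε⟩ := by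
    apply Complex.ext <;> (simp [pow_two]; try ring)
  rw [h1, one_div, Complex.inv_re, Complex.normSq_mk]
  congr 1
  ring

theorem abs_re_one_div_add_mul_I_sq_le (a : ℝ) {ε : ℝ} (hε : ε ≠ 0) :
    |(1 / ((a : ℂ) + (ε : ℂ) * Complex.I) ^ 2).re| ≤ (ε ^ 2)⁻¹ := by
  have h0 : 0 < ε ^ 2 := by positivity
  rw [re_one_div_add_mul_I_sq, abs_div, abs_of_pos (a := (a ^ 2 + ε ^ 2) ^ 2) (by positivity),
    div_le_iff₀ (by positivity), inv_mul_eq_div, le_div_iff₀ h0]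
  have : |a ^ 2 - ε ^ 2| ≤ a ^ 2 + ε ^ 2 := by
    rw [abs_le]; constructor <;> nlinarith [sq_nonneg a]
  nlinarith [sq_nonneg a]

/-- The antiderivative of `θ ↦ Re (r cos θ + iε)⁻²`. -/
theorem hasDerivAt_antideriv_re_inv_sq {r ε s : ℝ} (hε : 0 < ε) (hs : 0 < s)
    (hs2 : s ^ 2 = r ^ 2 + ε ^ 2) (θ : ℝ) :
    HasDerivAt (fun θ => r ^ 2 * (Real.sin θ * Real.cos θ) /
        (s ^ 2 * (r ^ 2 * Real.cos θ ^ 2 + ε ^ 2)) -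
      ε / s ^ 3 * (θ - Real.arctan ((s - ε) * (Real.sin θ * Real.cos θ) /
        (s * Real.cos θ ^ 2 + ε * Real.sin θ ^ 2))))
      (((r * Real.cos θ) ^ 2 - ε ^ 2) / ((r * Real.cos θ) ^ 2 + ε ^ 2) ^ 2) θ := by
  -- The term `θ - arctan (…)` is the continuous branch of `arctan ((ε / s) tan θ)`; written this
  -- way it is smooth across the poles of the tangent.
  have hsin := Real.hasDerivAt_sin θ
  have hcos := Real.hasDerivAt_cos θ
  have hsc := Real.sin_sq_add_cos_sq θ
  set S := Real.sin θ
  set C := Real.cos θ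
  have hD1 : 0 < r ^ 2 * C ^ 2 + ε ^ 2 := by positivity
  have hD2 : 0 < s * C ^ 2 + ε * S ^ 2 := by
    by_cases hC : C = 0
    · have : S ^ 2 = 1 := by nlinarith
      rw [hC, this]; simpa using hε
    · positivity
  have h1 := ((hsin.mul hcos).const_mul (r ^ 2)).div
    (((hcos.pow 2).const_mul (r ^ 2)).add_const (ε ^ 2) |>.const_mul (s ^ 2))
    (by positivity)
  have h2 := (((hsin.mul hcos).const_mul (s - ε)).div
    (((hcos.pow 2).const_mul s).add ((hsin.pow 2).const_mul ε)) hD2.ne').arctan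
  have h3 := h1.sub (((hasDerivAt_id θ).sub h2).const_mul (ε / s ^ 3))
  refine h3.congr_deriv ?_
  simp only [Pi.mul_apply, Pi.add_apply, Pi.pow_apply, show Real.sin θ = S from rfl,
    show Real.cos θ = C from rfl]
  have hS2 : S ^ 2 = 1 - C ^ 2 := by linarith
  have hr2 : r ^ 2 = s ^ 2 - ε ^ 2 := by linarith
  have e2 : (s * C ^ 2 + ε * S ^ 2) ^ 2 + ((s - ε) * (S * C)) ^ 2 = r ^ 2 * C ^ 2 + ε ^ 2 := by
    rw [hr2]
    linear_combination (s ^ 2 * C ^ 2 + ε ^ 2 * S ^ 2 + ε ^ 2) * hsc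
  set D := r ^ 2 * C ^ 2 + ε ^ 2 with hD
  set M := s * C ^ 2 + ε * S ^ 2 with hM
  -- The derivative of the arctangent correction; its complement to `1` is `s ε / D`, the derivative
  -- of `arctan ((ε / s) tan θ)`.
  have e3 : 1 / (1 + ((s - ε) * (S * C) / M) ^ 2) *
      (((s - ε) * (C * C + S * -S) * M - (s - ε) * (S * C) *
        (s * (2 * C * -S) + ε * (2 * S * C))) / M ^ 2) = 1 - s * ε / D := by
    have : 1 + ((s - ε) * (S * C) / M) ^ 2 = D / M ^ 2 := by
      rw [← e2]; field_simp
    rw [this]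
    field_simp
    rw [hM, hD, hr2]
    linear_combination (s - ε) * (s * C ^ 2 - ε * S ^ 2) * hsc + (ε ^ 2 - s * ε) * hsc
  have e4 : ((r * C) ^ 2 + ε ^ 2) = D := by rw [hD]; ring
  rw [e4]
  trans r ^ 2 * ((C * C + S * -S) * D + 2 * r ^ 2 * S ^ 2 * C ^ 2) / (s ^ 2 * D ^ 2) -
    ε / s ^ 3 * (s * ε / D)
  · rw [show s * ε / D = 1 - (1 - s * ε / D) by ring, ← e3]
    congr 1
    · field_simp
      ring
    · norm_num
      exact Or.inl (Or.inl rfl)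
  · have e5 : r ^ 2 * ((C * C + S * -S) * D + 2 * r ^ 2 * S ^ 2 * C ^ 2) - ε ^ 2 * D =
        s ^ 2 * ((r * C) ^ 2 - ε ^ 2) := by
      have : S * -S = C ^ 2 - 1 := by linarith
      rw [this, hS2, hs2, hD]
      ring
    rw [show ε / s ^ 3 * (s * ε / D) = ε ^ 2 * D / (s ^ 2 * D ^ 2) by field_simp, ← sub_div, e5]
    field_simp

/-- Over a full period every term of the antiderivative cancels except the linear one, which
contributes `-2π|ε| / s³`. -/
theorem intervalIntegral_re_inv_sq_cos (r : ℝ) {ε : ℝ} (hε : ε ≠ 0) :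
    ∫ θ in (0 : ℝ)..(2 * π), (1 / (((r * Real.cos θ : ℝ) : ℂ) + (ε : ℂ) * Complex.I) ^ 2).re =
      -(2 * π * |ε| / √(r ^ 2 + ε ^ 2) ^ 3) := by
  have hε' : 0 < |ε| := abs_pos.2 hε
  have hpos : 0 < r ^ 2 + ε ^ 2 := by positivity
  have hs : 0 < √(r ^ 2 + ε ^ 2) := Real.sqrt_pos.2 hpos
  simp only [re_one_div_add_mul_I_sq]
  rw [← sq_abs ε] at *
  rw [intervalIntegral.integral_eq_sub_of_hasDerivAt
    (fun θ _ => hasDerivAt_antideriv_re_inv_sq hε' hs (Real.sq_sqrt hpos.le) θ)]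
  · simp
    ring
  · refine Continuous.intervalIntegrable ?_ _ _
    refine Continuous.div (by fun_prop) (by fun_prop) fun θ => ?_
    positivity

/-- The average of the kernel `Re (t + iε)⁻²` over all directions is a multiple of the Poisson
kernel of the half-space. -/
theorem intervalIntegral_re_inv_sq_direction (u : ℂ) {ε : ℝ} (hε : ε ≠ 0) :
    ∫ φ in (0 : ℝ)..(2 * π), (1 / (((Complex.exp (-(φ : ℂ) * Complex.I) * u).re : ℂ) +
      (ε : ℂ) * Complex.I) ^ 2).re = -(2 * π * |ε| / √(‖u‖ ^ 2 + ε ^ 2) ^ 3) := by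
  rw [← intervalIntegral_re_inv_sq_cos ‖u‖ hε]
  set G : ℝ → ℝ := fun θ => (1 / (((‖u‖ * Real.cos θ : ℝ) : ℂ) + (ε : ℂ) * Complex.I) ^ 2).re
    with hG
  have hper : Function.Periodic G (2 * π) := fun θ => by simp only [hG, Real.cos_add_two_pi]
  have h1 : ∀ φ : ℝ, (Complex.exp (-(φ : ℂ) * Complex.I) * u).re =
      ‖u‖ * Real.cos (φ - u.arg) := by
    intro φ
    conv_lhs => rw [← Complex.norm_mul_exp_arg_mul_I u]
    rw [mul_left_comm, ← Complex.exp_add, ← add_mul, Complex.re_ofReal_mul,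
      show (-(φ : ℂ) + (u.arg : ℂ)) = ((u.arg - φ : ℝ) : ℂ) by push_cast; ring,
      Complex.exp_ofReal_mul_I_re, ← Real.cos_neg, neg_sub]
  simp_rw [h1]
  have := intervalIntegral.integral_comp_sub_right (a := 0) (b := 2 * π) G u.arg
  rw [this]
  have h2 := hper.intervalIntegral_add_eq (0 - u.arg) 0
  rw [zero_add, show 0 - u.arg + 2 * π = 2 * π - u.arg by ring] at h2
  exact h2

/-! ### The half-space Poisson kernel as an approximate identity. -/

/-- The Poisson kernel of the half-space `ℂ × (0, ∞)` at height `1`. -/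
noncomputable def halfSpaceKernel (u : ℂ) : ℝ := (2 * π)⁻¹ / √(‖u‖ ^ 2 + 1) ^ 3

/-- The Poisson integral of `h` at height `|ε|`. -/
noncomputable def poissonConv (h : ℂ → ℂ) (ε : ℝ) (z : ℂ) : ℂ :=
  ∫ w, ((2 * π)⁻¹ * |ε| / √(‖w - z‖ ^ 2 + ε ^ 2) ^ 3) • h w

theorem halfSpaceKernel_nonneg (u : ℂ) : 0 ≤ halfSpaceKernel u := by
  unfold halfSpaceKernel; positivity

theorem continuous_halfSpaceKernel : Continuous halfSpaceKernel := by
  unfold halfSpaceKernel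
  refine Continuous.div (by fun_prop) (by fun_prop) fun u => ?_
  positivity

theorem halfSpaceKernel_le (u : ℂ) : halfSpaceKernel u ≤ (2 * π)⁻¹ := by
  unfold halfSpaceKernel
  refine div_le_self (by positivity) (one_le_pow₀ ?_)
  rw [Real.one_le_sqrt]
  nlinarith [sq_nonneg ‖u‖]

theorem hasDerivAt_neg_inv_sqrt (r : ℝ) :
    HasDerivAt (fun r : ℝ => -(√(r ^ 2 + 1))⁻¹) (r * (1 / √(r ^ 2 + 1) ^ 3)) r := by
  have hpos : 0 < r ^ 2 + 1 := by positivity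
  have hs : 0 < √(r ^ 2 + 1) := Real.sqrt_pos.2 hpos
  have h1 : HasDerivAt (fun r : ℝ => r ^ 2 + 1) (2 * r) r := by
    simpa using (hasDerivAt_pow 2 r).add_const 1
  refine ((h1.sqrt hpos.ne').inv hs.ne').neg.congr_deriv ?_
  field_simp

theorem integral_Ioi_mul_inv_sqrt_pow_three :
    ∫ r in Set.Ioi (0 : ℝ), r * (1 / √(r ^ 2 + 1) ^ 3) = 1 := by
  rw [integral_Ioi_of_hasDerivAt_of_nonneg' (l := 0) (fun r _ => hasDerivAt_neg_inv_sqrt r)]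
  · simp
  · intro r hr
    have : (0 : ℝ) < r := hr
    positivity
  · rw [← neg_zero]
    refine (tendsto_inv_atTop_zero.comp (Real.tendsto_sqrt_atTop.comp ?_)).neg
    exact tendsto_atTop_add_const_right _ _ (tendsto_pow_atTop two_ne_zero)

theorem integral_halfSpaceKernel : ∫ u, halfSpaceKernel u = 1 := by
  rw [← Complex.integral_comp_polarCoord_symm, polarCoord_target]
  have h : ∀ p ∈ Set.Ioi (0 : ℝ) ×ˢ Set.Ioo (-π) π,
      p.1 • halfSpaceKernel (Complex.polarCoord.symm p) =
        (p.1 * (1 / √(p.1 ^ 2 + 1) ^ 3)) * (2 * π)⁻¹ := by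
    intro p _
    rw [halfSpaceKernel, Complex.norm_polarCoord_symm, sq_abs, smul_eq_mul]
    ring
  rw [setIntegral_congr_fun (measurableSet_Ioi.prod measurableSet_Ioo) h, Measure.volume_eq_prod,
    setIntegral_prod_mul (fun r : ℝ => r * (1 / √(r ^ 2 + 1) ^ 3)) (fun _ : ℝ => (2 * π)⁻¹),
    integral_Ioi_mul_inv_sqrt_pow_three, setIntegral_const, measureReal_def, Real.volume_Ioo,
    ENNReal.toReal_ofReal (by linarith [Real.pi_pos]), smul_eq_mul]
  field_simp
  ring

/-- The decay at infinity that makes the rescaled kernel converge for merely integrable `h`. -/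
theorem tendsto_norm_sq_mul_halfSpaceKernel :
    Tendsto (fun u : ℂ => ‖u‖ ^ Module.finrank ℝ ℂ * halfSpaceKernel u)
      (Bornology.cobounded ℂ) (𝓝 0) := by
  rw [Complex.finrank_real_complex]
  have h1 : Tendsto (fun u : ℂ => ‖u‖⁻¹) (Bornology.cobounded ℂ) (𝓝 0) :=
    tendsto_inv_atTop_zero.comp tendsto_norm_cobounded_atTop
  refine tendsto_of_tendsto_of_tendsto_of_le_of_le' tendsto_const_nhds h1
    (Eventually.of_forall fun u => mul_nonneg (by positivity) (halfSpaceKernel_nonneg u)) ?_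
  filter_upwards [tendsto_norm_cobounded_atTop.eventually_gt_atTop 0] with u hu
  have h2 : ‖u‖ ≤ √(‖u‖ ^ 2 + 1) := Real.le_sqrt_of_sq_le (by linarith)
  have h3 : (2 * π)⁻¹ ≤ 1 := inv_le_one_of_one_le₀ (by linarith [Real.pi_gt_three])
  calc ‖u‖ ^ 2 * halfSpaceKernel u ≤ ‖u‖ ^ 2 * (1 / ‖u‖ ^ 3) := by
        unfold halfSpaceKernel; gcongr
    _ = ‖u‖⁻¹ := by field_simp

theorem poissonConv_eq_peak (h : ℂ → ℂ) {ε : ℝ} (hε : ε ≠ 0) (z : ℂ) :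
    poissonConv h ε z =
      ∫ w, (|ε|⁻¹ ^ Module.finrank ℝ ℂ * halfSpaceKernel (|ε|⁻¹ • (z - w))) • h w := by
  have hε' : 0 < |ε| := abs_pos.2 hε
  unfold poissonConv
  congr 1
  ext1 w
  congr 1
  have : √(‖|ε|⁻¹ • (z - w)‖ ^ 2 + 1) = √(‖w - z‖ ^ 2 + ε ^ 2) / |ε| := by
    rw [← Real.sqrt_sq_eq_abs, ← Real.sqrt_div' _ (sq_nonneg ε), Real.sqrt_sq_eq_abs, norm_smul,
      norm_inv, Real.norm_eq_abs, abs_abs, norm_sub_rev, ← sq_abs ε]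
    congr 1
    field_simp
  rw [Complex.finrank_real_complex, halfSpaceKernel, this]
  field_simp

/-- Substituting `w = z - |ε| u` moves `ε` from the kernel to the function, giving an average of
translates. -/
theorem poissonConv_eq_integral_kernel (h : ℂ → ℂ) {ε : ℝ} (hε : ε ≠ 0) (z : ℂ) :
    poissonConv h ε z = ∫ u, halfSpaceKernel u • h (z - |ε| • u) := by
  have hε' : 0 < |ε| := abs_pos.2 hε
  have h1 := Measure.integral_comp_smul volume
    (fun u => halfSpaceKernel u • h (z - |ε| • u)) |ε|⁻¹
  have h2 := integral_sub_left_eq_self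
    (fun w => halfSpaceKernel (|ε|⁻¹ • w) • h (z - |ε| • |ε|⁻¹ • w)) volume z
  rw [← h2, Complex.finrank_real_complex] at h1
  rw [poissonConv_eq_peak h hε]
  simp_rw [mul_smul]
  rw [integral_smul, Complex.finrank_real_complex]
  simp only [smul_inv_smul₀ hε'.ne', sub_sub_cancel] at h1
  rw [h1, smul_smul, abs_of_pos (a := (|ε|⁻¹ ^ 2)⁻¹) (by positivity), mul_inv_cancel₀ (by positivity), one_smul]

theorem tendsto_poissonConv {h : ℂ → ℂ} (hi : Integrable h) {z : ℂ} (hc : ContinuousAt h z) :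
    Tendsto (fun ε => poissonConv h ε z) (𝓝[≠] 0) (𝓝 (h z)) := by
  have h1 := tendsto_integral_comp_smul_smul_of_integrable' halfSpaceKernel_nonneg
    integral_halfSpaceKernel tendsto_norm_sq_mul_halfSpaceKernel hi hc
  have h2 : Tendsto (fun ε : ℝ => |ε|⁻¹) (𝓝[≠] 0) atTop :=
    tendsto_inv_nhdsGT_zero.comp tendsto_abs_nhdsNE_zero
  refine (h1.comp h2).congr' ?_
  filter_upwards [self_mem_nhdsWithin] with ε hε
  exact (poissonConv_eq_peak h hε z).symm

/-- Translations are continuous in `L²`. -/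
theorem tendsto_lintegral_translate_sub {h : ℂ → ℂ} (h2 : MemLp h 2) :
    Tendsto (fun v : ℂ => ∫⁻ z, ‖h (z - v) - h z‖ₑ ^ 2) (𝓝 0) (𝓝 0) := by
  have hmp : ∀ v : ℂ, MeasurePreserving (fun z : ℂ => z - v) := fun v =>
    measurePreserving_sub_right volume v
  let g : ℂ → C(ℂ, ℂ) := fun v => ⟨fun z => z - v, by fun_prop⟩
  have hg : Continuous g :=
    (ContinuousMap.curry ⟨fun p : ℂ × ℂ => p.2 - p.1, by fun_prop⟩).continuous
  have h1 := Filter.Tendsto.compMeasurePreservingLp (tendsto_const_nhds (x := h2.toLp h))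
    (hg.tendsto 0) hmp (hmp 0) ENNReal.ofNat_ne_top
  simp only [g, ContinuousMap.coe_mk, Lp.toLp_compMeasurePreserving] at h1
  rw [Lp.tendsto_Lp_iff_tendsto_eLpNorm''] at h1
  have h3 := h1.ennrpow_const 2
  simp only [eLpNorm_eq_lintegral_rpow_enorm_toReal two_ne_zero ENNReal.ofNat_ne_top] at h3
  simp only [ENNReal.toReal_ofNat, ← ENNReal.rpow_mul, one_div,
    inv_mul_cancel₀ (two_ne_zero' ℝ), ENNReal.rpow_one] at h3
  simpa using h3

/-- The probability measure with density `halfSpaceKernel`. -/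
noncomputable def halfSpaceMeasure : Measure ℂ :=
  volume.withDensity fun u => ((halfSpaceKernel u).toNNReal : ℝ≥0∞)

theorem integrable_halfSpaceKernel : Integrable halfSpaceKernel :=
  integrable_of_integral_eq_one integral_halfSpaceKernel

instance isProbabilityMeasure_halfSpaceMeasure : IsProbabilityMeasure halfSpaceMeasure := by
  refine ⟨?_⟩
  rw [halfSpaceMeasure, withDensity_apply _ MeasurableSet.univ, Measure.restrict_univ]
  change ∫⁻ u, ENNReal.ofReal (halfSpaceKernel u) = 1
  rw [← ofReal_integral_eq_lintegral_ofReal integrable_halfSpaceKernel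
    (Eventually.of_forall halfSpaceKernel_nonneg), integral_halfSpaceKernel, ENNReal.ofReal_one]

theorem measurable_toNNReal_halfSpaceKernel :
    Measurable fun u => (halfSpaceKernel u).toNNReal :=
  continuous_halfSpaceKernel.measurable.real_toNNReal

theorem poissonConv_eq_integral_measure (h : ℂ → ℂ) {ε : ℝ} (hε : ε ≠ 0) (z : ℂ) :
    poissonConv h ε z = ∫ u, h (z - |ε| • u) ∂halfSpaceMeasure := by
  rw [halfSpaceMeasure, integral_withDensity_eq_integral_smul measurable_toNNReal_halfSpaceKernel,
    poissonConv_eq_integral_kernel h hε]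
  simp only [NNReal.smul_def, Real.coe_toNNReal _ (halfSpaceKernel_nonneg _)]

theorem integrable_halfSpaceMeasure {h : ℂ → ℂ} (hi : Integrable h) :
    Integrable h halfSpaceMeasure := by
  rw [halfSpaceMeasure, integrable_withDensity_iff_integrable_smul
    measurable_toNNReal_halfSpaceKernel]
  simp only [NNReal.smul_def, Real.coe_toNNReal _ (halfSpaceKernel_nonneg _)]
  refine Integrable.bdd_smul (φ := halfSpaceKernel) hi (2 * π)⁻¹ ?_ (Eventually.of_forall fun u => ?_)
  · exact continuous_halfSpaceKernel.aestronglyMeasurable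
  · rw [Real.norm_of_nonneg (halfSpaceKernel_nonneg u)]
    exact halfSpaceKernel_le u

/-- Jensen's inequality, as monotonicity of `L^p` norms on a probability space. -/
theorem enorm_integral_sq_le {μ : Measure ℂ} [IsProbabilityMeasure μ] {g : ℂ → ℂ}
    (hg : AEStronglyMeasurable g μ) : ‖∫ u, g u ∂μ‖ₑ ^ 2 ≤ ∫⁻ u, ‖g u‖ₑ ^ 2 ∂μ := by
  have h1 := eLpNorm_le_eLpNorm_of_exponent_le (p := 1) (q := 2) one_le_two hg
  rw [eLpNorm_one_eq_lintegral_enorm, eLpNorm_eq_lintegral_rpow_enorm_toReal two_ne_zero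
    ENNReal.ofNat_ne_top] at h1
  have h2 := pow_le_pow_left' ((enorm_integral_le_lintegral_enorm g).trans h1) 2
  refine h2.trans_eq ?_
  rw [← ENNReal.rpow_natCast, ← ENNReal.rpow_mul]
  simp

theorem lintegral_translate_sub_le {h : ℂ → ℂ} (hm : Measurable h) (v : ℂ) :
    ∫⁻ z, ‖h (z - v) - h z‖ₑ ^ 2 ≤ 4 * ∫⁻ z, ‖h z‖ₑ ^ 2 := by
  have key : ∀ a b : ℝ≥0∞, (a + b) ^ 2 ≤ 2 * a ^ 2 + 2 * b ^ 2 := by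
    intro a b
    have := ENNReal.rpow_add_le_mul_rpow_add_rpow a b (p := 2) (by norm_num)
    norm_num at this
    rwa [mul_add] at this
  calc ∫⁻ z, ‖h (z - v) - h z‖ₑ ^ 2
      ≤ ∫⁻ z, (2 * ‖h (z - v)‖ₑ ^ 2 + 2 * ‖h z‖ₑ ^ 2) := by
        refine lintegral_mono fun z => ?_
        exact (pow_le_pow_left' enorm_sub_le 2).trans (key _ _)
    _ = 4 * ∫⁻ z, ‖h z‖ₑ ^ 2 := by
        rw [lintegral_add_left (by fun_prop), lintegral_const_mul _ (by fun_prop),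
          lintegral_const_mul _ (by fun_prop),
          lintegral_sub_right_eq_self (fun z => ‖h z‖ₑ ^ 2) v, ← two_mul, ← mul_assoc]
        norm_num

theorem tendsto_lintegral_poissonConv_sub_of_measurable {h : ℂ → ℂ} (hm : Measurable h)
    (hi : Integrable h) (h2 : MemLp h 2) :
    Tendsto (fun ε => ∫⁻ z, ‖poissonConv h ε z - h z‖ₑ ^ 2) (𝓝[≠] 0) (𝓝 0) := by
  set T : ℂ → ℝ≥0∞ := fun v => ∫⁻ z, ‖h (z - v) - h z‖ₑ ^ 2 with hT
  have hTm : Measurable T := by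
    refine Measurable.lintegral_prod_right' (f := fun p : ℂ × ℂ => ‖h (p.2 - p.1) - h p.2‖ₑ ^ 2) ?_
    fun_prop
  -- Jensen and Tonelli bound the squared error by the average of `T`, the squared `L²` modulus of
  -- continuity. Dominated convergence with the constant `4 ‖h‖²` then finishes.
  have hle : ∀ ε : ℝ, ε ≠ 0 → ∫⁻ z, ‖poissonConv h ε z - h z‖ₑ ^ 2 ≤
      ∫⁻ u, T (|ε| • u) ∂halfSpaceMeasure := by
    intro ε hε
    have hε' : |ε| ≠ 0 := abs_ne_zero.2 hε
    calc ∫⁻ z, ‖poissonConv h ε z - h z‖ₑ ^ 2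
        ≤ ∫⁻ z, ∫⁻ u, ‖h (z - |ε| • u) - h z‖ₑ ^ 2 ∂halfSpaceMeasure := by
          refine lintegral_mono fun z => ?_
          have hint : Integrable (fun u => h (z - |ε| • u)) halfSpaceMeasure := by
            refine integrable_halfSpaceMeasure ?_
            exact (hi.comp_sub_left z).comp_smul hε'
          have : poissonConv h ε z - h z = ∫ u, (h (z - |ε| • u) - h z) ∂halfSpaceMeasure := by
            rw [integral_sub hint (integrable_const _), poissonConv_eq_integral_measure h hε,
              integral_const, probReal_univ, one_smul]
          rw [this]
          exact enorm_integral_sq_le (hint.1.sub aestronglyMeasurable_const)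
      _ = ∫⁻ u, T (|ε| • u) ∂halfSpaceMeasure := by
          rw [lintegral_lintegral_swap]
          fun_prop
  have hlim : Tendsto (fun ε : ℝ => ∫⁻ u, T (|ε| • u) ∂halfSpaceMeasure) (𝓝[≠] 0)
      (𝓝 (∫⁻ _, 0 ∂halfSpaceMeasure)) := by
    refine tendsto_lintegral_filter_of_dominated_convergence
      (fun _ => 4 * ∫⁻ z, ‖h z‖ₑ ^ 2) ?_ ?_ ?_ ?_
    · exact Eventually.of_forall fun ε => hTm.comp (measurable_const_smul _)
    · exact Eventually.of_forall fun ε => Eventually.of_forall fun u =>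
        lintegral_translate_sub_le hm _
    · rw [lintegral_const, measure_univ, mul_one]
      refine ENNReal.mul_ne_top ENNReal.ofNat_ne_top ?_
      have := h2.2
      rw [eLpNorm_lt_top_iff_lintegral_rpow_enorm_lt_top two_ne_zero ENNReal.ofNat_ne_top] at this
      simpa using this.ne
    · refine Eventually.of_forall fun u => (tendsto_lintegral_translate_sub h2).comp ?_
      have : Continuous fun ε : ℝ => |ε| • u := by fun_prop
      simpa using (this.tendsto 0).mono_left nhdsWithin_le_nhds
  rw [lintegral_zero] at hlim
  refine tendsto_of_tendsto_of_tendsto_of_le_of_le' tendsto_const_nhds hlim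
    (Eventually.of_forall fun _ => zero_le) ?_
  filter_upwards [self_mem_nhdsWithin] with ε hε using hle ε hε

/-- Passing to a measurable representative leaves the Poisson integrals unchanged. -/
theorem tendsto_lintegral_poissonConv_sub {h : ℂ → ℂ} (hi : Integrable h) (h2 : MemLp h 2) :
    Tendsto (fun ε => ∫⁻ z, ‖poissonConv h ε z - h z‖ₑ ^ 2) (𝓝[≠] 0) (𝓝 0) := by
  obtain ⟨g, hg, hgh⟩ := hi.1.aemeasurable
  refine (tendsto_lintegral_poissonConv_sub_of_measurable hg (hi.congr hgh)
    (h2.ae_eq hgh)).congr fun ε => ?_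
  have : ∀ z, poissonConv g ε z = poissonConv h ε z := fun z =>
    integral_congr_ae (hgh.mono fun w hw => by simp only [hw])
  refine lintegral_congr_ae (hgh.mono fun z hz => ?_)
  simp only [this, hz]

/-! ### Integration over lines -/

theorem measurePreserving_linePoint (φ : ℝ) :
    MeasurePreserving (fun p : ℝ × ℝ => linePoint p.1 φ p.2) := by
  have h1 := Complex.volume_preserving_equiv_real_prod.symm
  have h2 := (rotation (Circle.exp φ)).measurePreserving
  convert! h2.comp h1 using 1
  ext1 p
  simp only [Function.comp_apply, rotation_apply, Circle.coe_exp, linePoint]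
  congr 1
  apply Complex.ext <;> simp [Complex.measurableEquivRealProd]

theorem integrable_comp_linePoint {g : ℂ → ℂ} (hg : Integrable g) (φ : ℝ) :
    Integrable (fun p : ℝ × ℝ => g (linePoint p.1 φ p.2)) :=
  (measurePreserving_linePoint φ).integrable_comp_of_integrable hg

theorem measurableEmbedding_linePoint (φ : ℝ) :
    MeasurableEmbedding (fun p : ℝ × ℝ => linePoint p.1 φ p.2) := by
  refine (measurePreserving_linePoint φ).measurable.measurableEmbedding fun p q hpq => ?_
  have h := mul_left_cancel₀ (Complex.exp_ne_zero _) hpq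
  exact Prod.ext (by simpa using congrArg Complex.re h) (by simpa using congrArg Complex.im h)

theorem integral_integral_linePoint {g : ℂ → ℂ} (hg : Integrable g) (φ : ℝ) :
    ∫ t : ℝ, ∫ s : ℝ, g (linePoint t φ s) = ∫ w, g w := by
  rw [← (measurePreserving_linePoint φ).integral_comp (measurableEmbedding_linePoint φ),
    Measure.volume_eq_prod, integral_prod]
  exact integrable_comp_linePoint hg φ

/-- For each `φ` the coordinates `(t, s)` are a rotation of the plane; jointly with `φ` they form a
measure-preserving skew product, and integrating out `s` is Fubini. -/
theorem integrable_integral_linePoint {g : ℂ → ℂ} (hg : Integrable g) (ν : Measure ℝ)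
    [IsFiniteMeasure ν] :
    Integrable (fun p : ℝ × ℝ => ∫ s : ℝ, g (linePoint p.1 p.2 s)) (volume.prod ν) := by
  have h1 : MeasurePreserving (fun q : ℝ × (ℝ × ℝ) => (q.1, linePoint q.2.1 q.1 q.2.2))
      (ν.prod volume) (ν.prod volume) := by
    refine (MeasurePreserving.id ν).skew_product ?_
      (Eventually.of_forall fun φ => (measurePreserving_linePoint φ).map_eq)
    unfold linePoint
    fun_prop
  have h2 : Integrable (fun q : ℝ × (ℝ × ℝ) => g (linePoint q.2.1 q.1 q.2.2))
      (ν.prod volume) := h1.integrable_comp_of_integrable (hg.comp_snd ν)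
  have h3 : MeasurePreserving (fun q : (ℝ × ℝ) × ℝ => (q.1.2, (q.1.1, q.2)))
      ((volume.prod ν).prod volume) (ν.prod (volume.prod volume)) :=
    (measurePreserving_prodAssoc ν volume volume).comp
      ((Measure.measurePreserving_swap (μ := volume) (ν := ν)).prod (MeasurePreserving.id volume))
  exact (h3.integrable_comp_of_integrable h2).integral_prod_left

theorem re_exp_neg_mul_linePoint (t φ s : ℝ) :
    (Complex.exp (-(φ : ℂ) * Complex.I) * linePoint t φ s).re = t := by
  rw [linePoint, ← mul_assoc, ← Complex.exp_add, neg_mul, neg_add_cancel, Complex.exp_zero, one_mul]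
  simp

/-- The regularized integral over all lines is a Poisson integral. -/
theorem integral_lines_eq_poissonConv {h : ℂ → ℂ} (hh : Integrable h) {ε : ℝ} (hε : ε ≠ 0)
    (z : ℂ) :
    ∫ φ in (0 : ℝ)..(2 * π), ∫ t : ℝ,
      (1 / (((t - (Complex.exp (-(φ : ℂ) * Complex.I) * z).re : ℝ) : ℂ) +
        (ε : ℂ) * Complex.I) ^ 2).re • ∫ s : ℝ, h (linePoint t φ s) =
      (-(4 * π ^ 2)) • poissonConv h ε z := by
  set κ : ℝ → ℂ → ℝ := fun φ w => (1 / (((Complex.exp (-(φ : ℂ) * Complex.I) * (w - z)).re : ℂ) +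
    (ε : ℂ) * Complex.I) ^ 2).re with hκ
  have hκm : Measurable fun p : ℝ × ℂ => κ p.1 p.2 := by
    simp only [hκ]
    fun_prop
  -- For `ε ≠ 0` the kernel is bounded by `ε⁻²`, so Fubini applies.
  have hint : ∀ ν : Measure ℝ, IsFiniteMeasure ν →
      Integrable (fun p : ℝ × ℂ => κ p.1 p.2 • h p.2) (ν.prod volume) := by
    intro ν _
    refine Integrable.bdd_smul (φ := fun p : ℝ × ℂ => κ p.1 p.2) (hh.comp_snd ν) (ε ^ 2)⁻¹
      hκm.aestronglyMeasurable (Eventually.of_forall fun p => ?_)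
    exact abs_re_one_div_add_mul_I_sq_le _ hε
  have hint1 : ∀ φ : ℝ, Integrable fun w => κ φ w • h w := by
    intro φ
    refine Integrable.bdd_smul (φ := κ φ) hh (ε ^ 2)⁻¹
      (hκm.comp measurable_prodMk_left).aestronglyMeasurable (Eventually.of_forall fun p => ?_)
    exact abs_re_one_div_add_mul_I_sq_le _ hε
  have h1 : ∀ φ : ℝ, ∫ t : ℝ,
      (1 / (((t - (Complex.exp (-(φ : ℂ) * Complex.I) * z).re : ℝ) : ℂ) +
        (ε : ℂ) * Complex.I) ^ 2).re • ∫ s : ℝ, h (linePoint t φ s) =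
      ∫ w, κ φ w • h w := by
    intro φ
    -- The kernel `κ φ` is constant along each line of direction `φ`, so the `t` and `s` integrals
    -- combine into one over the plane.
    rw [← integral_integral_linePoint (hint1 φ) φ]
    congr 1
    ext1 t
    rw [← integral_smul]
    congr 1
    ext1 s
    simp only [hκ, mul_sub, Complex.sub_re, re_exp_neg_mul_linePoint]
  simp_rw [h1]
  rw [intervalIntegral.integral_of_le Real.two_pi_pos.le, integral_integral_swap
    (hint (volume.restrict (Set.Ioc 0 (2 * π))) inferInstance), poissonConv, ← integral_smul]
  congr 1
  ext1 w
  rw [integral_smul_const, ← intervalIntegral.integral_of_le Real.two_pi_pos.le,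
    intervalIntegral_re_inv_sq_direction (w - z) hε, smul_smul]
  congr 1
  have := Real.pi_pos
  field_simp
  ring

/-! ### Reconstruction from the curve integrals -/

theorem regIntegral_curveIntegral {k : ℕ} (hk : k ≠ 0) {f : ℂ → ℂ}
    (hf : ∀ x : ℂ, f (Complex.exp (2 * π * Complex.I / k) * x) = f x)
    (hi : Integrable (lineDensity k f)) {ε : ℝ} (hε : ε ≠ 0) (x : ℂ) :
    regIntegral k (curveIntegral k f) ε x =
      (-(4 * π ^ 2)) • poissonConv (lineDensity k f) ε (x ^ k) := by
  rw [← integral_lines_eq_poissonConv hi hε, regIntegral]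
  simp only [curveIntegral_eq hk hf, genFun_eq]

theorem smul_regIntegral_curveIntegral {k : ℕ} (hk : k ≠ 0) {f : ℂ → ℂ}
    (hf : ∀ x : ℂ, f (Complex.exp (2 * π * Complex.I / k) * x) = f x)
    (hi : Integrable (lineDensity k f)) {ε : ℝ} (hε : ε ≠ 0) (x : ℂ) :
    (-(k * ‖x‖ ^ (k - 1) / (4 * π ^ 2))) • regIntegral k (curveIntegral k f) ε x =
      (k * ‖x‖ ^ (k - 1)) • poissonConv (lineDensity k f) ε (x ^ k) := by
  rw [regIntegral_curveIntegral hk hf hi hε, smul_smul]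
  congr 1
  have := Real.pi_pos
  field_simp

/-- The derivatives of the power map and of its inverse have reciprocal norms. -/
theorem smul_lineDensity_pow {k : ℕ} (hk : k ≠ 0) {f : ℂ → ℂ}
    (hf : ∀ x : ℂ, f (Complex.exp (2 * π * Complex.I / k) * x) = f x) {x : ℂ} (hx : x ≠ 0) :
    (k * ‖x‖ ^ (k - 1)) • lineDensity k f (x ^ k) = f x := by
  have hk' : (0 : ℝ) < k := by exact_mod_cast Nat.pos_of_ne_zero hk
  have hx' : 0 < ‖x‖ := norm_pos_iff.2 hx
  rw [lineDensity, eq_of_pow_eq_pow hk hf (root_pow hk (x ^ k)), smul_smul]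
  have h1 : ‖x ^ k‖ ^ ((k : ℝ)⁻¹ - 1) = ‖x‖ / ‖x‖ ^ k := by
    rw [norm_pow, Real.rpow_sub (by positivity), Real.pow_rpow_inv_natCast hx'.le hk, Real.rpow_one]
  have h2 : ‖x‖ ^ k = ‖x‖ ^ (k - 1) * ‖x‖ := by
    rw [← pow_succ, Nat.sub_add_cancel (Nat.pos_of_ne_zero hk)]
  have h3 : k * ‖x‖ ^ (k - 1) * ((k : ℝ)⁻¹ * ‖x ^ k‖ ^ ((k : ℝ)⁻¹ - 1)) = 1 := by
    rw [h1, h2]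
    field_simp
  rw [h3, one_smul]

theorem continuousAt_lineDensity_pow {k : ℕ} (hk : k ≠ 0) {f : ℂ → ℂ}
    (hf : ∀ x : ℂ, f (Complex.exp (2 * π * Complex.I / k) * x) = f x) {x : ℂ} (hx : x ≠ 0)
    (hc : ContinuousAt f x) : ContinuousAt (lineDensity k f) (x ^ k) := by
  have hxk : x ^ k ≠ 0 := pow_ne_zero _ hx
  have h1 : ContinuousAt (fun z : ℂ => (k : ℝ)⁻¹ * ‖z‖ ^ ((k : ℝ)⁻¹ - 1)) (x ^ k) :=
    continuousAt_const.mul (continuousAt_id.norm.rpow_const (Or.inl (norm_ne_zero_iff.2 hxk)))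
  have h2 : ContinuousAt (fun z : ℂ => f (root k z)) (x ^ k) := by
    -- The root jumps across its cut, so continuity is tested after composing with `x ↦ x ^ k`,
    -- which carries the neighbourhood filter of `x` to that of `x ^ k`; invariance then turns `f ∘
    -- root k` into `f`.
    have hmap := (hasStrictDerivAt_pow_natCast k x).map_nhds_eq
      (mul_ne_zero (Nat.cast_ne_zero.2 hk) (pow_ne_zero _ hx))
    rw [ContinuousAt, ← hmap, tendsto_map'_iff]
    have h3 : (fun z : ℂ => f (root k z)) ∘ (fun x : ℂ => x ^ k) = f :=
      funext fun y => eq_of_pow_eq_pow hk hf (root_pow hk (y ^ k))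
    rw [h3, eq_of_pow_eq_pow hk hf (root_pow hk (x ^ k))]
    exact hc
  exact h1.smul h2

theorem tendsto_regIntegral_curveIntegral {k : ℕ} (hk : k ≠ 0) {f : ℂ → ℂ}
    (hf : ∀ x : ℂ, f (Complex.exp (2 * π * Complex.I / k) * x) = f x)
    (hi : Integrable (lineDensity k f)) {x : ℂ} (hx : x ≠ 0) (hc : ContinuousAt f x) :
    Tendsto (fun ε => (-(k * ‖x‖ ^ (k - 1) / (4 * π ^ 2))) •
      regIntegral k (curveIntegral k f) ε x) (𝓝[≠] 0) (𝓝 (f x)) := by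
  have h := (tendsto_poissonConv hi (continuousAt_lineDensity_pow hk hf hx hc)).const_smul
    ((k : ℝ) * ‖x‖ ^ (k - 1))
  rw [smul_lineDensity_pow hk hf hx] at h
  refine h.congr' ?_
  filter_upwards [self_mem_nhdsWithin] with ε hε
  exact (smul_regIntegral_curveIntegral hk hf hi hε x).symm

theorem tendstoL2Loc_regIntegral_curveIntegral {k : ℕ} (hk : k ≠ 0) {f : ℂ → ℂ}
    (hf : ∀ x : ℂ, f (Complex.exp (2 * π * Complex.I / k) * x) = f x)
    (hi : Integrable (lineDensity k f)) (h2 : MemLp (lineDensity k f) 2) :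
    TendstoL2Loc (fun ε x => (-(k * ‖x‖ ^ (k - 1) / (4 * π ^ 2))) •
      regIntegral k (curveIntegral k f) ε x) f := by
  intro K hK h0
  obtain ⟨N, hN⟩ := exists_lintegral_comp_pow_le hk hK h0
  have h1 := ENNReal.Tendsto.const_mul (a := (N : ℝ≥0∞)) (tendsto_lintegral_poissonConv_sub hi h2)
    (Or.inr (ENNReal.natCast_ne_top N))
  rw [mul_zero] at h1
  have h3 : Tendsto (fun ε => ∫⁻ x in K, ‖(-(k * ‖x‖ ^ (k - 1) / (4 * π ^ 2))) •
      regIntegral k (curveIntegral k f) ε x - f x‖ₑ ^ 2) (𝓝[≠] 0) (𝓝 0) := by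
    refine tendsto_of_tendsto_of_tendsto_of_le_of_le' tendsto_const_nhds h1
      (Eventually.of_forall fun _ => zero_le) ?_
    filter_upwards [self_mem_nhdsWithin] with ε hε
    -- The prefactor squared is the Jacobian of the power map, so the error over `K` is at most `N`
    -- times the error over the plane.
    refine le_trans (setLIntegral_mono' hK.measurableSet fun x hx => ?_)
      (hN fun z => ‖poissonConv (lineDensity k f) ε z - lineDensity k f z‖ₑ ^ 2)
    have hx0 : x ≠ 0 := fun h => h0 (h ▸ hx)
    rw [smul_regIntegral_curveIntegral hk hf hi hε, ← smul_lineDensity_pow hk hf hx0, ← smul_sub,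
      enorm_smul, mul_pow, Real.enorm_eq_ofReal (by positivity), ENNReal.ofReal_pow (by positivity)]
  have h4 := h3.ennrpow_const (1 / 2)
  simp only [eLpNorm_eq_lintegral_rpow_enorm_toReal two_ne_zero ENNReal.ofNat_ne_top]
  simpa using h4

/-! ### Reduction of the Funk-Radon transform to curve integrals -/

/-- The gradient of the real part of a holomorphic function is the conjugate of its derivative, and
the phase `e^{-iφ}` has modulus one. -/
theorem norm_gradient_genFun (k : ℕ) (x : ℂ) (t φ : ℝ) :
    ‖gradient (fun y : ℂ => genFun k y t φ) x‖ = k * ‖x‖ ^ (k - 1) := by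
  set c := Complex.exp (-(φ : ℂ) * Complex.I) with hc
  have hcn : ‖c‖ = 1 := by
    rw [hc, ← Complex.ofReal_neg, Complex.norm_exp_ofReal_mul_I]
  have h1 : HasFDerivAt (fun y : ℂ => c * y ^ k) _ x :=
    hasFDerivAt_real_of_hasDerivAt
      (((hasStrictDerivAt_pow_natCast k x).hasDerivAt).const_mul c)
  have h2 := (Complex.reCLM.hasFDerivAt.comp x h1).const_sub t
  have h3 : HasGradientAt (fun y : ℂ => genFun k y t φ)
      (-(starRingEnd ℂ) (c * (k * x ^ (k - 1)))) x := by
    rw [hasGradientAt_iff_hasFDerivAt]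
    have h4 : (fun y : ℂ => genFun k y t φ) = fun y => t - (c * y ^ k).re :=
      funext fun y => genFun_eq k y t φ
    rw [h4]
    refine h2.congr_fderiv ?_
    ext
    all_goals simp [Complex.inner]
  rw [h3.gradient, norm_neg, RCLike.norm_conj, norm_mul, hcn, one_mul, norm_mul, norm_pow,
    Complex.norm_natCast]

/-- The function whose curve integrals are the Funk-Radon transform of `f`. -/
noncomputable def divGradient (k : ℕ) (f : ℂ → ℂ) (x : ℂ) : ℂ :=
  ((k : ℝ) * ‖x‖ ^ (k - 1))⁻¹ • f x

theorem inv_norm_gradient_smul (k : ℕ) (f : ℂ → ℂ) (t φ : ℝ) :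
    (fun x => ‖gradient (fun y : ℂ => genFun k y t φ) x‖⁻¹ • f x) = divGradient k f :=
  funext fun x => by rw [norm_gradient_genFun, divGradient]

theorem funkRadon_eq (k : ℕ) (f : ℂ → ℂ) :
    funkRadon k f = curveIntegral k (divGradient k f) := by
  ext t φ
  rw [funkRadon, inv_norm_gradient_smul]

theorem divGradient_rotate {k : ℕ} {f : ℂ → ℂ}
    (hf : ∀ x : ℂ, f (Complex.exp (2 * π * Complex.I / k) * x) = f x) (x : ℂ) :
    divGradient k f (Complex.exp (2 * π * Complex.I / k) * x) = divGradient k f x := by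
  have h : ‖Complex.exp (2 * π * Complex.I / k)‖ = 1 := by
    rw [show 2 * (π : ℂ) * Complex.I / k = ((2 * π / k : ℝ) : ℂ) * Complex.I by push_cast; ring,
      Complex.norm_exp_ofReal_mul_I]
  rw [divGradient, divGradient, hf, norm_mul, h, one_mul]

/-- The weight blows up only at the origin (for `k > 1`), from which the support of `f` keeps a
distance `δ`. -/
theorem memLp_divGradient {k : ℕ} (hk : k ≠ 0) {f : ℂ → ℂ} (hf : MemLp f 2)
    (h0 : (0 : ℂ) ∉ tsupport f) : MemLp (divGradient k f) 2 := by
  have hk' : (0 : ℝ) < k := by exact_mod_cast Nat.pos_of_ne_zero hk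
  obtain ⟨δ, hδ, hball⟩ := Metric.isOpen_iff.1 (isClosed_tsupport f).isOpen_compl 0 h0
  have hm : Measurable fun x : ℂ => ((k : ℝ) * ‖x‖ ^ (k - 1))⁻¹ := by fun_prop
  refine MemLp.of_le_mul (c := ((k : ℝ) * δ ^ (k - 1))⁻¹) hf (hm.aestronglyMeasurable.smul hf.1)
    (Eventually.of_forall fun x => ?_)
  rw [divGradient, norm_smul]
  by_cases hx : f x = 0
  · simp [hx]
  have hδx : δ ≤ ‖x‖ := by
    by_contra hcon
    push Not at hcon
    exact hball (mem_ball_zero_iff.2 hcon) (subset_tsupport f hx)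
  rw [Real.norm_of_nonneg (by positivity)]
  gcongr

theorem hasCompactSupport_divGradient {k : ℕ} {f : ℂ → ℂ} (hf : HasCompactSupport f) :
    HasCompactSupport (divGradient k f) :=
  hf.smul_left (f := fun x : ℂ => ((k : ℝ) * ‖x‖ ^ (k - 1))⁻¹)

theorem smul_divGradient {k : ℕ} (hk : k ≠ 0) (f : ℂ → ℂ) {x : ℂ} (hx : x ≠ 0) :
    ((k : ℝ) * ‖x‖ ^ (k - 1)) • divGradient k f x = f x := by
  rw [divGradient, smul_inv_smul₀]
  exact mul_ne_zero (Nat.cast_ne_zero.2 hk) (pow_ne_zero _ (norm_ne_zero_iff.2 hx))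

theorem smul_regIntegral_funkRadon (k : ℕ) (f : ℂ → ℂ) (ε : ℝ) (x : ℂ) :
    (-(k ^ 2 * ‖x‖ ^ (2 * k - 2) / (4 * π ^ 2))) • regIntegral k (funkRadon k f) ε x =
      ((k : ℝ) * ‖x‖ ^ (k - 1)) • (-(k * ‖x‖ ^ (k - 1) / (4 * π ^ 2))) •
        regIntegral k (curveIntegral k (divGradient k f)) ε x := by
  rw [funkRadon_eq, smul_smul, show 2 * k - 2 = (k - 1) + (k - 1) by omega, pow_add]
  congr 1
  ring

theorem tendsto_regIntegral_funkRadon {k : ℕ} (hk : k ≠ 0) {f : ℂ → ℂ}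
    (hf : ∀ x : ℂ, f (Complex.exp (2 * π * Complex.I / k) * x) = f x)
    (hi : Integrable (lineDensity k (divGradient k f))) {x : ℂ} (hx : x ≠ 0)
    (hc : ContinuousAt f x) :
    Tendsto (fun ε => (-(k ^ 2 * ‖x‖ ^ (2 * k - 2) / (4 * π ^ 2))) •
      regIntegral k (funkRadon k f) ε x) (𝓝[≠] 0) (𝓝 (f x)) := by
  have hc' : ContinuousAt (divGradient k f) x := by
    have hw : ContinuousAt (fun y : ℂ => (k : ℝ) * ‖y‖ ^ (k - 1)) x := by fun_prop
    refine (hw.inv₀ ?_).smul hc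
    exact mul_ne_zero (Nat.cast_ne_zero.2 hk) (pow_ne_zero _ (norm_ne_zero_iff.2 hx))
  have h := (tendsto_regIntegral_curveIntegral hk (divGradient_rotate hf) hi hx hc').const_smul
    ((k : ℝ) * ‖x‖ ^ (k - 1))
  rw [smul_divGradient hk f hx] at h
  exact h.congr fun ε => (smul_regIntegral_funkRadon k f ε x).symm

theorem tendstoL2Loc_regIntegral_funkRadon {k : ℕ} (hk : k ≠ 0) {f : ℂ → ℂ}
    (hf : ∀ x : ℂ, f (Complex.exp (2 * π * Complex.I / k) * x) = f x)
    (hi : Integrable (lineDensity k (divGradient k f)))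
    (h2 : MemLp (lineDensity k (divGradient k f)) 2) :
    TendstoL2Loc (fun ε x => (-(k ^ 2 * ‖x‖ ^ (2 * k - 2) / (4 * π ^ 2))) •
      regIntegral k (funkRadon k f) ε x) f := by
  intro K hK h0
  obtain ⟨R, hR⟩ := hK.isBounded.subset_closedBall 0
  have h1 := tendstoL2Loc_regIntegral_curveIntegral hk (divGradient_rotate hf) hi h2 K hK h0
  -- On `K` the extra factor `k |x|^{k-1}` relating the two formulas is at most `k R^{k-1}`.
  have h3 := ENNReal.Tendsto.const_mul (a := ENNReal.ofReal (k * R ^ (k - 1))) h1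
    (Or.inr ENNReal.ofReal_ne_top)
  rw [mul_zero] at h3
  refine tendsto_of_tendsto_of_tendsto_of_le_of_le tendsto_const_nhds h3 (fun _ => zero_le)
    fun ε => ?_
  refine eLpNorm_le_mul_eLpNorm_of_ae_le_mul ?_ 2
  filter_upwards [ae_restrict_mem hK.measurableSet] with x hx
  have hx0 : x ≠ 0 := fun h => h0 (h ▸ hx)
  have hxR : ‖x‖ ≤ R := mem_closedBall_zero_iff.1 (hR hx)
  rw [smul_regIntegral_funkRadon]
  nth_rewrite 1 [← smul_divGradient hk f hx0]
  rw [← smul_sub, norm_smul, Real.norm_of_nonneg (by positivity)]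
  gcongr

end Cormack

theorem mainTheorem8 (k : ℕ) (hk : 1 ≤ k) :
    -- the curves generated by `Φ` are the `α`-curves with `α = k`
    (∀ t φ : ℝ, Cormack.zeroSet k (-t) φ = Cormack.zeroSet k t (φ + π)) ∧
    (∀ t φ : ℝ, 0 ≤ t →
      Cormack.curve k t φ = Cormack.alphaCurve k t (φ / k) ∧
      Cormack.zeroSet k t φ = ⋃ j : Fin k, Cormack.alphaCurve k t ((φ + 2 * π * (j : ℕ)) / k)) ∧
    ∀ f : ℂ → ℂ, MemLp f 2 volume → HasCompactSupport f → (0 : ℂ) ∉ tsupport f →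
      (∀ x : ℂ, f (Complex.exp (2 * π * Complex.I / k) * x) = f x) →
      -- the integral transforms are defined almost everywhere, and integrable
      (∀ φ : ℝ, ∀ᵐ t : ℝ, IntegrableOn f (Cormack.curve k t φ) (μH[1])) ∧
      (∀ φ : ℝ, ∀ᵐ t : ℝ, IntegrableOn
        (fun x => ‖gradient (fun y : ℂ => Cormack.genFun k y t φ) x‖⁻¹ • f x)
        (Cormack.curve k t φ) (μH[1])) ∧
      Integrable (fun p : ℝ × ℝ => Cormack.curveIntegral k f p.1 p.2)
        ((volume : Measure ℝ).prod (volume.restrict (Set.Ioc 0 (2 * π)))) ∧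
      Integrable (fun p : ℝ × ℝ => Cormack.funkRadon k f p.1 p.2)
        ((volume : Measure ℝ).prod (volume.restrict (Set.Ioc 0 (2 * π)))) ∧
      -- reconstruction from the curve integrals
      Cormack.TendstoL2Loc (fun ε x => (-(k * ‖x‖ ^ (k - 1) / (4 * π ^ 2))) •
        Cormack.regIntegral k (Cormack.curveIntegral k f) ε x) f ∧
      (∀ x : ℂ, x ≠ 0 → ContinuousAt f x →
        Tendsto (fun ε => (-(k * ‖x‖ ^ (k - 1) / (4 * π ^ 2))) •
          Cormack.regIntegral k (Cormack.curveIntegral k f) ε x) (𝓝[≠] 0) (𝓝 (f x))) ∧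
      -- reconstruction from the Funk-Radon transform
      Cormack.TendstoL2Loc (fun ε x => (-(k ^ 2 * ‖x‖ ^ (2 * k - 2) / (4 * π ^ 2))) •
        Cormack.regIntegral k (Cormack.funkRadon k f) ε x) f ∧
      (∀ x : ℂ, x ≠ 0 → ContinuousAt f x →
        Tendsto (fun ε => (-(k ^ 2 * ‖x‖ ^ (2 * k - 2) / (4 * π ^ 2))) •
          Cormack.regIntegral k (Cormack.funkRadon k f) ε x) (𝓝[≠] 0) (𝓝 (f x))) := by
  have hk0 : k ≠ 0 := by omega
  refine ⟨Cormack.zeroSet_neg k, fun t φ ht => ⟨Cormack.curve_eq_alphaCurve hk0 ht φ,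
    Cormack.zeroSet_eq_iUnion_alphaCurve hk0 ht φ⟩, fun f h2 hc h0 hf => ?_⟩
  have hf' := Cormack.divGradient_rotate hf
  have h2' := Cormack.memLp_divGradient hk0 h2 h0
  have hi := Cormack.integrable_lineDensity hk0 h2 hc
  have hi' := Cormack.integrable_lineDensity hk0 h2' (Cormack.hasCompactSupport_divGradient hc)
  refine ⟨fun φ => ?_, fun φ => ?_, ?_, ?_,
    Cormack.tendstoL2Loc_regIntegral_curveIntegral hk0 hf hi (Cormack.memLp_lineDensity hk0 h2),
    fun x hx hcx => Cormack.tendsto_regIntegral_curveIntegral hk0 hf hi hx hcx,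
    Cormack.tendstoL2Loc_regIntegral_funkRadon hk0 hf hi' (Cormack.memLp_lineDensity hk0 h2'),
    fun x hx hcx => Cormack.tendsto_regIntegral_funkRadon hk0 hf hi' hx hcx⟩
  · simp only [Cormack.integrableOn_curve_iff hk0 hf]
    -- Fubini in the rotated coordinates: almost every line section of an integrable function is
    -- integrable.
    exact (Cormack.integrable_comp_linePoint hi φ).prod_right_ae
  · simp only [Cormack.inv_norm_gradient_smul, Cormack.integrableOn_curve_iff hk0 hf']
    exact (Cormack.integrable_comp_linePoint hi' φ).prod_right_ae
  · simp only [Cormack.curveIntegral_eq hk0 hf]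
    exact Cormack.integrable_integral_linePoint hi _
  · simp only [Cormack.funkRadon_eq, Cormack.curveIntegral_eq hk0 hf']
    exact Cormack.integrable_integral_linePoint hi' _
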